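/- Notation. $Y=(y^\alpha,\bar y^{\dot\alpha})$ ($\alpha,\dot\alpha\in\{1,2\}$) are commuting spinor variables, $p_\alpha=-i\partial/\partial y^\alpha$, indices are moved with $\epsilon_{\alpha\beta}$, $(ab)=a_\alpha b^\alpha$; $k,\bar k$ are the exterior Klein operators ($k$ anticommutes with $y$, $\bar k$ with $\bar y$, $k^2=\bar k^2=1$, $[k,\bar k]=0$), $K=(k,\bar k)$; fields take values in an associative colour algebra; $h^{\alpha\dot\alpha}$ is the background vierbein, $D_L=h^{\alpha\dot\alpha}D_{\alpha\dot\alpha}$ the Lorentz covariant derivative, $D(u,\bar u)=u^\alpha\bar u^{\dot\alpha}D_{\alpha\dot\alpha}$, $h(a,\bar a)=h_{\alpha\dot\alpha}a^\alpha\bar a^{\dot\alpha}$, $\bar H(\bar a,\bar b)=\frac12h_{\gamma\dot\alpha}h^{\gamma}{}_{\dot\beta}\bar a^{\dot\alpha}\bar b^{\dot\beta}$. $f_{m,n}$ is the part of $f(Y)$ of degree $m$ in $y$ and $n$ in $\bar y$; c.c. exchanges dotted and undotted spinors, $k$ and $\bar k$, $\eta$ and $\bar\eta$. Spins are nonnegative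 integers or half-integers, $[s]$ is the integer part and $\{s\}=s-[s]$. Fields. A Fronsdal field of spin $s$ is $\phi_{s+\{s\},s-\{s\}}$, $\phi_{s-\{s\},s+\{s\}}$ (equal for bosons). The spin-$s$ master fields are the one-form $\omega=\sum_{a+b=2s-2}\omega_{a,b}$ with $\omega_{a,b}=-h(p,\bar p)\phi_{a+1,b+1}$, and the zero-form $C=\sum_{n\ge0}(C_{2s+n,n}+C_{n,2s+n})$, where, up to numerical coefficients, $\phi_{s+\{s\}+m,s-\{s\}-m}=D^m(y,\bar p)\phi_{s+\{s\},s-\{s\}}$, $C_{2s+n,n}=D^n(y,\bar y)D^{[s]}(y,\bar p)\phi_{s+\{s\},s-\{s\}}\bar k$, and the conjugate formulae hold. A component of bidegree $(a,b)$ has helicity of positive (negative) sign if $a\ge b$ ($a\le b$). Vertices. With all expressions evaluated at $Y_1=Y_2=0$, $$\Upsilon(\omega,\omega)=-e^{-i(p_1p_2)+i(p_1y)+i(p_2y)-i(\bar p_1\bar p_2)+i(\bar p_1\bar y)+i(\bar p_2\bar y)}\,\omega(Y_1;K)\omega(Y_2;K),$$ $$\Upsilon(\Omega,\omega,C)=-\tfrac{i\eta}2\int_0^1\!dt\,h(p_1,t\bar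 p_1+\bar p_2)\,e^{-it(p_1p_2)+i(1-t)(p_1y)-i(\bar p_1\bar p_2)+i(\bar p_1\bar y)+i(\bar p_2\bar y)}\big[\omega(Y_1;K)C(Y_2;K)-e^{-2i(\bar p_1\bar y)}C(Y_2;K)\omega(-Y_1;K)\big]k+c.c.,$$ $$\Upsilon(\Omega,\Omega,C,C)=-\tfrac{i\eta\bar\eta}4\int\!\frac{d^4t}{t_4^2}\delta(1-t_3-t_4)\delta'(1-t_1-t_2)\bar H(\bar p,\bar p)\,e^{it_1(p_1y)-it_2(p_2y)-it_3(\bar p_1\bar p_2)+it_2t_4(\bar p_1\bar y)-it_1t_4(\bar p_2\bar y)}\,C(Y_1;K)C(Y_2;K)k\bar k+c.c.$$ (integral over $t_i\ge 0$), $$\Upsilon(\omega,C)=-e^{-i(p_1p_2)+i(p_1y)+i(p_2y)-i(\bar p_1\bar p_2)+i(\bar p_1\bar y)+i(\bar p_2\bar y)}\big[\omega(Y_1;K)C(Y_2;K)-C(Y_1;K)\omega(Y_2;K)\big],$$ $$\Upsilon(\Omega,C,C)=\tfrac{i\eta}2\int_0^1\!dt\,h(y,(1-t)\bar p_1-t\bar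 p_2)\,e^{it(p_1y)-i(1-t)(p_2y)-i(\bar p_1\bar p_2)+i(\bar p_1\bar y)+i(\bar p_2\bar y)}\,C(Y_1;K)C(Y_2;K)k+c.c.$$ Currents. Let $\Upsilon_{m,n}(u,v|Y)$ and $\Upsilon_{m,n}(\bar u,\bar v|Y)$ be the contractions with $u^\alpha v^\beta$, $\bar u^{\dot\alpha}\bar v^{\dot\beta}$ of the coefficients of $h^{\alpha}{}_{\dot\gamma}h^{\beta\dot\gamma}$ and $h_\gamma{}^{\dot\alpha}h^{\gamma\dot\beta}$ in a two-form $\Upsilon_{m,n}$, and $\Upsilon_{m,n}(u,\bar v|Y)$ the contraction of the coefficient of $h^{\alpha\dot\alpha}$ in a one-form. The Fronsdal current of spin $s_1$ is, in the one-form sector, for integer $s_1=s\ge1$, $$J_{s,s}=\tfrac1{2s}\Upsilon_{s,s-2}(\bar y,\bar y|Y)+\tfrac{i}{2s^2(s+1)}\big[D(p,\bar y)\Upsilon_{s-1,s-1}(y,y|Y)+sD(y,\bar y)\Upsilon_{s-1,s-1}(y,p|Y)\big]+c.c.$$ (without the first term if $s=1$) and, for $s\ge2$, $$J_{s-2,s-2}=\tfrac12\Upsilon_{s,s-2}(p,p|Y)+\tfrac{i}{2s(s-1)}\big[D(p,\bar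 y)\Upsilon_{s-1,s-1}(\bar p,\bar p|Y)-sD(p,\bar p)\Upsilon_{s-1,s-1}(\bar y,\bar p|Y)\big]+c.c.;$$ for half-integer $s_1=s\ge3/2$, with $\Upsilon=\Upsilon_{s-1/2,s-3/2}$, it consists of $\frac1{s-1/2}\Upsilon(\bar y,\bar y|Y)$, $-\frac1{s+1/2}\Upsilon(p,p|Y)$, $-i\frac{s^2-1/4}{2s}\big[(s+\frac12)\Upsilon(y,p|Y)+(s-\frac12)\Upsilon(\bar y,\bar p|Y)\big]$ and their conjugates. In the zero-form sector it is $-\frac12[i\Upsilon_{1,1}(p,\bar p|Y)-D(p,\bar p)\Upsilon_{0,0}(y,\bar y|0)]$ for $s_1=0$, $\Upsilon_{0,1}(y,\bar p|0,\bar y)$ and its conjugate for $s_1=\frac12$, $-\frac\eta4\Upsilon_{0,2}(y,\bar p|0,\bar y)+c.c.$ for $s_1=1$. Let the two factors of a vertex (in this order) have spins $s_2,s_3$, and let $\mathcal S=[s_1]+[s_2]+[s_3]$. The number $\#_{der}$ of derivatives of a term is the number of symbols $D$ in it after $\omega$, $C$ have been expressed through the Fronsdal fields. Theorem. (0) For one-forms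 of spins $s_2,s_3$ the spin-$s_1$ part (total degree $2s_1-2$ in $Y$) of $\Upsilon(\omega,\omega)$ vanishes unless the triangle inequalities $$s_1+s_2\ge s_3+1,\qquad s_1+s_3\ge s_2+1,\qquad s_2+s_3\ge s_1+1\tag{T}$$ hold. (1) One-form sector. In each case, the vertex contributes to the Fronsdal current only in the cases listed, and all terms of the contribution satisfy the condition given. $\Upsilon(\omega,\omega)$: only if (T) holds; $\#_{der}\le\mathcal S-2s_1$ if the helicities of the factors have the same sign, $\#_{der}\le\mathcal S-2\max\{s_2,s_3\}$ if they have opposite signs. $\Upsilon(\Omega,\omega,C)$ (either order of $\omega$, $C$): under (T), $\#_{der}\le\mathcal S-2\min\{s_1,s_2,s_3\}$; if $s_2=s_1+s_3$, $\#_{der}\le\mathcal S-2\min\{s_1,s_3\}$; if $s_3=s_1+s_2$, $\#_{der}\le\mathcal S-2\min\{s_1,s_2\}$; if $s_2>s_1+s_3$, $\#_{der}\le\mathcal S$ for equal and $\#_{der}\le\mathcal S-2\min\{s_1,s_3\}$ for opposite signs of the helicities; if $s_3>s_1+s_2$, $\#_{der}\le\mathcal S$ for equal and $\#_{der}\le\mathcal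 S-2\min\{s_1,s_2\}$ for opposite signs. $\Upsilon(\Omega,\Omega,C,C)$: for equal signs of the helicities only if (T), $s_2=s_1+s_3$, $s_3=s_1+s_2$ or $s_1\ge s_2+s_3$ holds, with $\#_{der}=\mathcal S$; for opposite signs only if $s_1\ge s_2+s_3$, with $\#_{der}=\mathcal S-2\min\{s_2,s_3\}$. The complete currents (all helicities) contain only the terms so allowed. In particular, under (T) the current from $\Upsilon(\omega,\omega)+\Upsilon(\Omega,\omega,C)$ has $\#_{der}\le\mathcal S-2\min\{s_1,s_2,s_3\}$ and the current from $\Upsilon(\Omega,\Omega,C,C)$ has $\#_{der}=\mathcal S$. (2) Zero-form sector, $s_1\in\{0,\frac12,1\}$. Every term contributed by $\Upsilon(\omega,C)$ (either order) satisfies one of: $s_1\in\{\frac12,1\}$, $s_2+s_3\ge s_1+1$ and $\#_{der}=\mathcal S-2\min\{s_1,s_2,s_3\}$; or $|s_2-s_3|\ge s_1+1$ and $\#_{der}=\mathcal S$; or $s_1=1$, $s_2+s_3\ge 2$, the spin of $C$ is $0$ or $\frac12$, and $\#_{der}=\mathcal S-2$. Every term contributed by $\Upsilon(\Omega,C,C)$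 satisfies one of: $s_1\in\{\frac12,1\}$, $s_2+s_3\le s_1$ and $\#_{der}=\mathcal S-2\min\{s_1,s_2,s_3\}$; or $s_1\in\{\frac12,1\}$, $|s_2-s_3|\le s_1$ and $\#_{der}=\mathcal S$; or $s_1=0$, $|s_2-s_3|\le1$, $s_2+s_3\ge1$ and $\#_{der}=[s_2]+[s_3]$. -/

import Mathlib

namespace HigherSpin

open scoped ContDiff

noncomputable section

/-! ### Space-time functions -/

/-- Coordinates of a four-dimensional space-time patch. -/
abbrev SpaceTime := Fin 4 → ℝ

/-- Smooth functions on the patch with values in the (associative, possibly noncommutative)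
colour algebra `A`. -/
def SmoothFun (A : Type*) [NormedRing A] [NormedAlgebra ℂ A] :
    Subalgebra ℂ (SpaceTime → A) where
  carrier := {f | ContDiff ℝ ∞ f}
  mul_mem' hf hg := by
    simp only [Set.mem_ofPred_eq] at hf hg ⊢
    exact hf.mul hg
  add_mem' hf hg := by
    simp only [Set.mem_ofPred_eq] at hf hg ⊢
    exact hf.add hg
  algebraMap_mem' c := by
    change ContDiff ℝ ∞ fun _ : SpaceTime => algebraMap ℂ A c
    exact contDiff_const

variable {A : Type*} [NormedRing A] [NormedAlgebra ℂ A]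

/-- The coordinate derivative `∂/∂xⁿ`. -/
def pdX (n : Fin 4) (f : SmoothFun A) : SmoothFun A :=
  ⟨fun x => fderiv ℝ f.1 x (Pi.single n 1),
    (ContDiff.fderiv_right (m := ∞) (show ContDiff ℝ ∞ f.1 from f.2) (by simp)).clm_apply
      contDiff_const⟩

/-- Product of a complex function and an `A`-valued function. -/
def scal (g : SmoothFun ℂ) (f : SmoothFun A) : SmoothFun A :=
  ⟨fun x => g.1 x • f.1 x, ContDiff.smul (show ContDiff ℝ ∞ g.1 from g.2) (show ContDiff ℝ ∞ f.1 from f.2)⟩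

/-! ### Generating functions

`true` labels undotted spinors and `false` dotted ones, so complex conjugation of formulae is the
exchange `χ ↔ !χ`. -/

/-- The four commuting variables `y^α = (true, α)` and `ȳ^α̇ = (false, α̇)`. -/
abbrev Var := Bool × Fin 2

/-- Exponents of monomials in `Y = (y, ȳ)`. -/
abbrev Expo := Var →₀ ℕ

/-- Degree in the undotted (`χ = true`) or dotted (`χ = false`) variables. -/
def deg (χ : Bool) (μ : Expo) : ℕ := ∑ a, μ (χ, a)

/-- Words `k^i k̄^j` in the exterior Klein operators: `κ true = i`, `κ false = j`. -/
abbrev Klein := Bool → ZMod 2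

variable (A) in
/-- Formal power series `f(Y; K | x)`: for every monomial of `Y` and every Klein word a function
of `x` with values in `A`; Klein operators are written to the right. -/
abbrev Gen := Expo → Klein → SmoothFun A

/-- The function of chirality with value `u` at `χ` and `v` at `!χ`. -/
def pair {T : Type*} (χ : Bool) (u v : T) : Bool → T := fun c => if c = χ then u else v

/-- `f_{m,n}(Y)`: the part of degree `m true` in `y` and `m false` in `ȳ`. -/
def comp (m : Bool → ℕ) (f : Gen A) : Gen A :=
  fun μ => if ∀ χ, deg χ μ = m χ then f μ else 0

/-- The part of nonnegative (`τ = true`) or nonpositive (`τ = false`) helicity: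
`deg y ≥ deg ȳ`, respectively `deg y ≤ deg ȳ`. -/
def helPart (τ : Bool) (f : Gen A) : Gen A :=
  fun μ => if deg (!τ) μ ≤ deg τ μ then f μ else 0

/-- `f(-Y)`. -/
def reflect (f : Gen A) : Gen A := fun μ => (-1 : ℂ) ^ (deg true μ + deg false μ) • f μ

/-- `f k` for `χ = true` and `f k̄` for `χ = false`. -/
def mulK (χ : Bool) (f : Gen A) : Gen A := fun μ κ => f μ (κ - Pi.single χ 1)

/-- The antisymmetric symbol, `ε 0 1 = 1`; it is both `ε_{αβ}` and `ε^{αβ}`. -/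
def eps (a b : Fin 2) : ℂ := !![0, 1; -1, 0] a b

/-- `∂/∂y^α` or `∂/∂ȳ^α̇`. -/
def pdY (v : Var) (f : Gen A) : Gen A :=
  fun μ => ((μ v : ℂ) + 1) • f (μ + Finsupp.single v 1)

/-- Multiplication by `y^α` or `ȳ^α̇`. -/
def mulY (v : Var) (f : Gen A) : Gen A :=
  fun μ => if μ v = 0 then 0 else f (μ - Finsupp.single v 1)

/-- The spinor operators with upper index: `y^α`, and `p^α = ε^{αβ} p_β` with
`p_β = -i ∂/∂y^β`. -/
inductive Slot
  | y
  | p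

/-- `y^a` or `p^a` of chirality `χ`, acting on everything to the right. -/
def Slot.act (s : Slot) (χ : Bool) (a : Fin 2) (f : Gen A) : Gen A :=
  match s with
  | .y => mulY (χ, a) f
  | .p => ∑ b, (eps a b * (-Complex.I)) • pdY (χ, b) f

/-! ### Background and Lorentz covariant derivative -/

/-- A background: vierbein `h^{αα̇} = dxⁿ h_n^{αα̇}` with its inverse `e^n_{αα̇}`, and a Lorentz
connection `ϖ_{αβ}` (`χ = true`), `ϖ̄_{α̇β̇}` (`χ = false`). A pair `(α, α̇)` is a function `ι`
with `ι true = α`, `ι false = α̇`. -/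
structure Background where
  /-- `h_n^{αα̇}` -/
  h : Fin 4 → (Bool → Fin 2) → SmoothFun ℂ
  /-- `e^n_{αα̇}` -/
  e : Fin 4 → (Bool → Fin 2) → SmoothFun ℂ
  /-- `ϖ_{n αβ}` and `ϖ̄_{n α̇β̇}` -/
  conn : Fin 4 → Bool → Fin 2 → Fin 2 → SmoothFun ℂ
  e_h : ∀ ι ι', ∑ n, e n ι * h n ι' = if ι = ι' then 1 else 0
  h_e : ∀ n n', ∑ ι, h n ι * e n' ι = if n = n' then 1 else 0
  conn_symm : ∀ n χ a b, conn n χ a b = conn n χ b a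

/-- Product of a function of `x` and a generating function. -/
def scalG (g : SmoothFun ℂ) (f : Gen A) : Gen A := fun μ κ => scal g (f μ κ)

/-- The components `D_n = ∂_n + i ϖ_{n αβ} y^α p^β + i ϖ̄_{n α̇β̇} ȳ^α̇ p̄^β̇` of the Lorentz
covariant derivative `D_L`. -/
def Background.lorentz (bg : Background) (n : Fin 4) (f : Gen A) : Gen A :=
  (fun μ κ => pdX n (f μ κ)) +
    ∑ χ, ∑ a, ∑ b, Complex.I • scalG (bg.conn n χ a b) (Slot.y.act χ a (Slot.p.act χ b f))

/-- The frame components `D_{αα̇}`, defined by `D_L = h^{αα̇} D_{αα̇}`. -/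
def Background.covD (bg : Background) (ι : Bool → Fin 2) (f : Gen A) : Gen A :=
  ∑ n, scalG (bg.e n ι) (bg.lorentz n f)

/-- `lam D(u, ū) = lam u^α ū^α̇ D_{αα̇}` with `u` of chirality `χ` and `ū` of chirality `!χ`.
The formal parameter `lam` counts space-time derivatives. -/
def Background.D (bg : Background) (lam : ℂ) (χ : Bool) (u v : Slot) (f : Gen A) : Gen A :=
  lam • ∑ a, ∑ b, u.act χ a (v.act (!χ) b (bg.covD (pair χ a b) f))

/-! ### Differential forms -/

variable (A) in
/-- A one-form `h^{αα̇} w_{αα̇}(Y; K | x)`. -/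
abbrev OneForm := (Bool → Fin 2) → Gen A

variable (A) in
/-- A two-form `H^{αβ} B_{αβ} + H̄^{α̇β̇} B̄_{α̇β̇}` with `B = B true`, `B̄ = B false` symmetric, where
`H^{αβ} = h^α_{γ̇} h^{βγ̇}`, `H̄^{α̇β̇} = h_γ^α̇ h^{γβ̇}`. -/
abbrev TwoForm := Bool → Fin 2 → Fin 2 → Gen A

/-- The two-form `h^{αα̇} ∧ h^{ββ̇} T_{αα̇,ββ̇}`, by
`h^{αα̇} ∧ h^{ββ̇} = (ε^{α̇β̇} H^{αβ} + ε^{αβ} H̄^{α̇β̇}) / 2`. -/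
def wedge (T : (Bool → Fin 2) → (Bool → Fin 2) → Gen A) : TwoForm A :=
  fun χ a b => ∑ c, ∑ d, (eps c d / 4) •
    (T (pair χ a c) (pair χ b d) + T (pair χ b c) (pair χ a d))

/-- `w(u, ū | Y) = u^α ū^α̇ w_{αα̇}(Y)`, `u` of chirality `χ`. -/
def OneForm.at (w : OneForm A) (χ : Bool) (u v : Slot) : Gen A :=
  ∑ a, ∑ b, u.act χ a (v.act (!χ) b (w (pair χ a b)))

/-- `B(u, v | Y) = u^α v^β B_{αβ}(Y)` in the part of chirality `χ`. -/
def TwoForm.at (B : TwoForm A) (χ : Bool) (u v : Slot) : Gen A :=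
  ∑ a, ∑ b, u.act χ a (v.act χ b (B χ a b))

/-- Bidegree component of a one-form. -/
def OneForm.part (w : OneForm A) (m : Bool → ℕ) : OneForm A := fun ι => comp m (w ι)

/-- Bidegree component of a two-form. -/
def TwoForm.part (B : TwoForm A) (m : Bool → ℕ) : TwoForm A := fun χ a b => comp m (B χ a b)

/-- A one-form of spin `N / 2`: only monomials of total degree `N - 2`. -/
def OneForm.HasSpin (w : OneForm A) (N : ℕ) : Prop :=
  ∀ ι μ, w ι μ ≠ 0 → deg true μ + deg false μ + 2 = N

/-- The spin `N / 2` part of a two-form: the monomials of total degree `N - 2`. -/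
def TwoForm.spinPart (B : TwoForm A) (N : ℕ) : TwoForm A :=
  fun χ a b μ => if deg true μ + deg false μ + 2 = N then B χ a b μ else 0

/-! ### Bilinear vertices

A vertex is `F(Y, P₁, P₂) f(Y₁; K) g(Y₂; K) |_{Y₁ = Y₂ = 0}`, with a kernel `F` that is a power
series in the variables `Y` (leg `0`), `P₁` (leg `1`) and `P₂` (leg `2`); the `p_i` carry lower
indices. -/

/-- Polynomials in the variables `Y`, `P₁`, `P₂`. -/
abbrev Sym := MvPolynomial (Fin 3 × Var) ℂ

/-- The variable of leg `i`, chirality `χ`, index `a`. -/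
def leg (i : Fin 3) (χ : Bool) (a : Fin 2) : Sym := MvPolynomial.X (i, (χ, a))

/-- `(p_i y) = (p_i)_α y^α`. -/
def py (χ : Bool) (i : Fin 3) : Sym := ∑ a, leg i χ a * leg 0 χ a

/-- `(p_i p_j) = (p_i)_α (p_j)^α = ε^{αβ} (p_i)_α (p_j)_β`. -/
def pp (χ : Bool) (i j : Fin 3) : Sym := ∑ a, ∑ b, MvPolynomial.C (eps a b) * leg i χ a * leg j χ b

/-- `y_α = y^β ε_{βα}`. -/
def yLow (χ : Bool) (a : Fin 2) : Sym := ∑ b, MvPolynomial.C (eps b a) * leg 0 χ b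

/-- The coefficients of the kernel `F`: exponents of `Y`, `P₁`, `P₂`. -/
abbrev Kernel := Expo → Expo → Expo → ℂ

/-- The exponent of `Y^μ P₁^ν P₂^ρ`. -/
def joinExpo (μ ν ρ : Expo) : Fin 3 × Var →₀ ℕ :=
  Finsupp.equivFunOnFinite.symm fun v => ![μ, ν, ρ] v.1 v.2

/-- The power series `G exp(q)` for `q` without constant term. Terms `G q^j` of the exponential
series with `j` larger than the degree of a monomial do not contribute to its coefficient. -/
def expKernel (G q : Sym) : Kernel := fun μ ν ρ =>
  ∑ j ∈ Finset.range ((joinExpo μ ν ρ).degree + 1),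
    MvPolynomial.coeff (joinExpo μ ν ρ) (G * q ^ j) / (j.factorial : ℂ)

/-- Product of the coefficient `u` of `Y₁^ν` and the coefficient `v` of `Y₂^ρ`: the Klein operators
of the first factor are moved to the right, `k f(y) = f(-y) k`, `k̄ f(ȳ) = f(-ȳ) k̄`. -/
def twMul (ρ : Expo) (u v : Klein → SmoothFun A) : Klein → SmoothFun A := fun κ =>
  ∑ κ₁ : Klein, (∏ χ, if κ₁ χ = 1 then (-1 : ℂ) ^ deg χ ρ else 1) • (u κ₁ * v (κ - κ₁))

/-- `ν! = ∏ ν_v!`, with the factor `(-i)^{|ν|}`: the value of `P^ν Y^ν`, `p_α = -i ∂/∂y^α`. -/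
def pairing (ν : Expo) : ℂ := (-Complex.I) ^ ν.degree * ∏ v, ((ν v).factorial : ℂ)

/-- `F(Y, P₁, P₂) f(Y₁; K) g(Y₂; K) |_{Y₁ = Y₂ = 0}`. -/
def Kernel.apply (F : Kernel) (f g : Gen A) : Gen A := fun μ =>
  ∑ᶠ νρ : Expo × Expo, (F μ νρ.1 νρ.2 * pairing νρ.1 * pairing νρ.2) •
    twMul νρ.2 (f νρ.1) (g νρ.2)

/-- Coupling constant: `η` for `χ = true` and `η̄` for `χ = false`. -/
def coupling (η : ℂ) (χ : Bool) : ℂ := if χ then η else (starRingEnd ℂ) η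

/-- Exponent of the star product,
`- i (p₁p₂) + i (p₁y) + i (p₂y) - i (p̄₁p̄₂) + i (p̄₁ȳ) + i (p̄₂ȳ)`. -/
def starKernel : Kernel :=
  expKernel 1 (∑ χ, MvPolynomial.C Complex.I * (-pp χ 1 2 + py χ 1 + py χ 2))

/-- `Υ(ω, ω) = - ω ⋆ ω` with fixed order of the two factors. -/
def vertexWW (w₂ w₃ : OneForm A) : TwoForm A :=
  wedge fun ι ι' => -(starKernel.apply (w₂ ι) (w₃ ι'))

/-- Kernel of `Υ(Ω, ω, C)`, component `αα̇ = ι` of `h`: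
`∫₀¹ dt (p_w)_α (t p̄_w + p̄_c)_α̇
  exp{ - i t (p_w p_c) + i (1 - t)(p_w y) - i (p̄_w p̄_c) + i σ (p̄_w ȳ) + i (p̄_c ȳ) }`,
where `w` and `c` are the legs of `ω` and `C`, and `σ = ±1`; `χ = false` is the conjugate. -/
def kernelWC (χ : Bool) (w c : Fin 3) (σ : ℂ) (ι : Bool → Fin 2) : Kernel := fun μ ν ρ =>
  ∫ t in (0 : ℝ)..1,
    expKernel
      (leg w χ (ι χ) * (MvPolynomial.C (t : ℂ) * leg w (!χ) (ι (!χ)) + leg c (!χ) (ι (!χ))))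
      (MvPolynomial.C (-Complex.I * t) * pp χ w c + MvPolynomial.C (Complex.I * (1 - t)) * py χ w
        - MvPolynomial.C Complex.I * pp (!χ) w c + MvPolynomial.C (Complex.I * σ) * py (!χ) w
        + MvPolynomial.C Complex.I * py (!χ) c) μ ν ρ

/-- The `ω C`-ordered part of `Υ(Ω, ω, C)`. -/
def vertexWC (η : ℂ) (w : OneForm A) (C : Gen A) : TwoForm A :=
  wedge fun ι ι' => ∑ χ, (-(Complex.I * coupling η χ) / 2) •
    mulK χ ((kernelWC χ 1 2 1 ι).apply (w ι') C)

/-- The `C ω`-ordered part of `Υ(Ω, ω, C)`, with `C(Y₂; K) ω(-Y₁; K)` and the additional factor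
`- exp(- 2 i (p̄₁ȳ))`; here the first factor `C` is leg `1` and `ω` is leg `2`. -/
def vertexCW (η : ℂ) (C : Gen A) (w : OneForm A) : TwoForm A :=
  wedge fun ι ι' => ∑ χ, (Complex.I * coupling η χ / 2) •
    mulK χ ((kernelWC χ 2 1 (-1) ι).apply C (reflect (w ι')))

/-- Integrand of the kernel of `Υ(Ω, Ω, C, C)` in front of `H̄^{α̇β̇} / 2`. Acting on the exponential
below, `p̄_α̇ p̄_β̇ / t₄²` gives `(t₂ p̄₁ - t₁ p̄₂)_α̇ (t₂ p̄₁ - t₁ p̄₂)_β̇`; the exponent is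
`i t₁ (p₁y) - i t₂ (p₂y) - i t₃ (p̄₁p̄₂) + i t₂ t₄ (p̄₁ȳ) - i t₁ t₄ (p̄₂ȳ)`. -/
def kernelCCAux (χ : Bool) (a b : Fin 2) (t₁ t₂ t₃ t₄ : ℝ) : Kernel :=
  expKernel
    ((MvPolynomial.C (t₂ : ℂ) * leg 1 (!χ) a - MvPolynomial.C (t₁ : ℂ) * leg 2 (!χ) a) *
      (MvPolynomial.C (t₂ : ℂ) * leg 1 (!χ) b - MvPolynomial.C (t₁ : ℂ) * leg 2 (!χ) b))
    (MvPolynomial.C (Complex.I * t₁) * py χ 1 - MvPolynomial.C (Complex.I * t₂) * py χ 2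
      - MvPolynomial.C (Complex.I * t₃) * pp (!χ) 1 2
      + MvPolynomial.C (Complex.I * t₂ * t₄) * py (!χ) 1
      - MvPolynomial.C (Complex.I * t₁ * t₄) * py (!χ) 2)

/-- The integral of the integrand over nonnegative `t` with `δ(1 - t₃ - t₄) δ'(1 - t₁ - t₂)`:
integration against `δ'(1 - r)` is the derivative at `r = 1` of the integral over
`t₁ + t₂ = r`. -/
def kernelCC (χ : Bool) (a b : Fin 2) : Kernel := fun μ ν ρ =>
  ∫ t₄ in (0 : ℝ)..1,
    deriv (fun r : ℝ => ∫ t₁ in (0 : ℝ)..r, kernelCCAux χ a b t₁ (r - t₁) (1 - t₄) t₄ μ ν ρ) 1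

/-- `Υ(Ω, Ω, C, C)`: the term `χ = true` is proportional to `H̄(p̄, p̄)`, its conjugate to
`H(p, p)`. -/
def vertexCC (η : ℂ) (C₂ C₃ : Gen A) : TwoForm A := fun χ a b =>
  (-(Complex.I * coupling η true * coupling η false) / 8) •
    mulK true (mulK false ((kernelCC (!χ) a b).apply C₂ C₃))

/-- The `ω C`-ordered part of `Υ(ω, C) = - [ω, C]_⋆`. -/
def vertex0WC (w : OneForm A) (C : Gen A) : OneForm A := fun ι => -(starKernel.apply (w ι) C)

/-- The `C ω`-ordered part of `Υ(ω, C) = - [ω, C]_⋆`. -/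
def vertex0CW (C : Gen A) (w : OneForm A) : OneForm A := fun ι => starKernel.apply C (w ι)

/-- Kernel of `Υ(Ω, C, C)`, component `αα̇ = ι` of `h`:
`∫₀¹ dt y_α ((1 - t) p̄₁ - t p̄₂)_α̇
  exp{ i t (p₁y) - i (1 - t)(p₂y) - i (p̄₁p̄₂) + i (p̄₁ȳ) + i (p̄₂ȳ) }`. -/
def kernel0CC (χ : Bool) (ι : Bool → Fin 2) : Kernel := fun μ ν ρ =>
  ∫ t in (0 : ℝ)..1,
    expKernel
      (yLow χ (ι χ) * (MvPolynomial.C ((1 : ℂ) - t) * leg 1 (!χ) (ι (!χ))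
        - MvPolynomial.C (t : ℂ) * leg 2 (!χ) (ι (!χ))))
      (MvPolynomial.C (Complex.I * t) * py χ 1 - MvPolynomial.C (Complex.I * (1 - t)) * py χ 2
        - MvPolynomial.C Complex.I * pp (!χ) 1 2 + MvPolynomial.C Complex.I * py (!χ) 1
        + MvPolynomial.C Complex.I * py (!χ) 2) μ ν ρ

/-- `Υ(Ω, C, C)`. -/
def vertex0CC (η : ℂ) (C₂ C₃ : Gen A) : OneForm A := fun ι =>
  ∑ χ, (Complex.I * coupling η χ / 2) • mulK χ ((kernel0CC χ ι).apply C₂ C₃)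

/-! ### Master fields of fixed spin in terms of the Fronsdal field

The spin `s = N / 2` is given by the natural number `N = 2 s`; then `[s] = N / 2` and
`s + {s} = (N + 1) / 2` with division in `ℕ`. -/

variable (A) in
/-- A Fronsdal (or Fang-Fronsdal) field of spin `N / 2` in the transverse-traceless gauge, without
its differential constraints: `φ true = φ_{s+{s}, s-{s}}(Y; K)` and
`φ false = φ_{s-{s}, s+{s}}(Y; K)`, which coincide for bosons. For spin `0` and `1/2` these are the
scalar and the two-component spinor fields. -/
structure FronsdalField (N : ℕ) where
  φ : Bool → Gen A
  homogeneous : ∀ χ μ, φ χ μ ≠ 0 → deg χ μ = (N + 1) / 2 ∧ deg (!χ) μ = N / 2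
  boson : Even N → φ true = φ false
  klein : ∀ χ μ κ, κ true ≠ κ false → φ χ μ κ = 0

/-- Numerical coefficients in the expressions of `ω` and `C` through the Fronsdal field; they
depend on the spin, the number of the component and the chirality (and on `η`). -/
structure Coefficients where
  /-- coefficients of the components of `ω` -/
  gauge : ℕ → Bool → ℕ → ℂ
  /-- coefficients of the components of `C` -/
  weyl : ℕ → Bool → ℕ → ℂ

/-- For `χ = true`, `φ_{s+{s}+m, s-{s}-m} = c D^m(y, p̄) φ_{s+{s}, s-{s}}`; for `χ = false` the
conjugate. -/
def FronsdalField.tower {N : ℕ} (Φ : FronsdalField A N) (bg : Background) (lam : ℂ)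
    (co : Coefficients) (χ : Bool) (m : ℕ) : Gen A :=
  co.gauge N χ m • (bg.D lam χ .y .p)^[m] (Φ.φ χ)

/-- The gauge one-form `ω = ∑ ω_{a,b}`, `a + b = 2 (s - 1)`, with `ω_{a,b} = - h(p, p̄) φ_{a+1,b+1}`,
i.e. `(ω_{a,b})_{αα̇} = ∂_α ∂̄_α̇ φ_{a+1,b+1}`. -/
def FronsdalField.omega {N : ℕ} (Φ : FronsdalField A N) (bg : Background) (lam : ℂ)
    (co : Coefficients) : OneForm A := fun ι μ =>
  if deg true μ + deg false μ + 2 = N then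
    if deg false μ ≤ deg true μ then
      pdY (true, ι true) (pdY (false, ι false)
        (Φ.tower bg lam co true ((deg true μ - deg false μ) / 2))) μ
    else
      pdY (true, ι true) (pdY (false, ι false)
        (Φ.tower bg lam co false ((deg false μ - deg true μ) / 2))) μ
  else 0

/-- For `χ = true`, `C_{2s+n,n} = c D^n(y, ȳ) D^{[s]}(y, p̄) φ_{s+{s}, s-{s}} k̄`; for `χ = false`
the conjugate `C_{n,2s+n}`. -/
def FronsdalField.weylComp {N : ℕ} (Φ : FronsdalField A N) (bg : Background) (lam : ℂ)
    (co : Coefficients) (χ : Bool) (n : ℕ) : Gen A :=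
  co.weyl N χ n • mulK (!χ) ((bg.D lam χ .y .y)^[n] ((bg.D lam χ .y .p)^[N / 2] (Φ.φ χ)))

/-- The zero-form `C = ∑ (C_{n,2s+n} + C_{2s+n,n})` (for `s = 0` there is one component for each
`n`). -/
def FronsdalField.weyl {N : ℕ} (Φ : FronsdalField A N) (bg : Background) (lam : ℂ)
    (co : Coefficients) : Gen A := fun μ =>
  if deg true μ = N + deg false μ then Φ.weylComp bg lam co true (deg false μ) μ
  else if deg false μ = N + deg true μ then Φ.weylComp bg lam co false (deg true μ) μ
  else 0

/-- Helicity part of a one-form. -/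
def OneForm.hel (τ : Bool) (w : OneForm A) : OneForm A := fun ι => helPart τ (w ι)

/-! ### Projection to Fronsdal currents -/

/-- Labels of the irreducible components of the current of the equations of a given spin.
Bosons use `main false` and `trace false` only; fermions use all labels, the Boolean being the
chirality. -/
inductive CurrentLabel
  | main (χ : Bool)
  | trace (χ : Bool)
  | gammaTrace (χ : Bool)

variable (A) in
/-- The collection of components of a current. -/
abbrev Current := CurrentLabel → Gen A

/-- `J_{s,s}` for integer `s ≥ 1`:
`Υ_{s,s-2}(ȳ,ȳ|Y) / (2s)
  + i / (2 s² (s+1)) [D(p,ȳ) Υ_{s-1,s-1}(y,y|Y) + s D(y,ȳ) Υ_{s-1,s-1}(y,p|Y)] + c.c.`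
For `s = 1` there is no `Υ_{s,s-2}`, and this is the contribution of the one-form sector to the
Yang-Mills current. -/
def bosonMain (bg : Background) (lam : ℂ) (s : ℕ) (B : TwoForm A) : Gen A :=
  ∑ χ, ((if 2 ≤ s then (1 / (2 * s) : ℂ) • (B.part (pair χ s (s - 2))).at (!χ) .y .y else 0) +
    (Complex.I / (2 * s ^ 2 * (s + 1))) •
      (bg.D lam χ .p .y ((B.part (pair χ (s - 1) (s - 1))).at χ .y .y) +
        (s : ℂ) • bg.D lam χ .y .y ((B.part (pair χ (s - 1) (s - 1))).at χ .y .p)))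

/-- `J_{s-2,s-2}` for integer `s ≥ 2`:
`Υ_{s,s-2}(p,p|Y) / 2
  + i / (2 s (s-1)) [D(p,ȳ) Υ_{s-1,s-1}(p̄,p̄|Y) - s D(p,p̄) Υ_{s-1,s-1}(ȳ,p̄|Y)] + c.c.` -/
def bosonTrace (bg : Background) (lam : ℂ) (s : ℕ) (B : TwoForm A) : Gen A :=
  ∑ χ, ((1 / 2 : ℂ) • (B.part (pair χ s (s - 2))).at χ .p .p +
    (Complex.I / (2 * s * (s - 1))) •
      (bg.D lam χ .p .y ((B.part (pair χ (s - 1) (s - 1))).at (!χ) .p .p) -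
        (s : ℂ) • bg.D lam χ .p .p ((B.part (pair χ (s - 1) (s - 1))).at (!χ) .y .p)))

/-- The Fronsdal current of spin `N / 2 ≥ 1` determined by the right-hand side `B` of the equation
for the one-form `ω`. For half-integer `s`, with `Υ = Υ_{s-1/2,s-3/2}`, it consists of
`Υ(ȳ,ȳ|Y) / (s-1/2)`, `- Υ(p,p|Y) / (s+1/2)`,
`- i (s²-1/4) / (2s) [(s+1/2) Υ(y,p|Y) + (s-1/2) Υ(ȳ,p̄|Y)]` and of their conjugates. -/
def currentOne (bg : Background) (lam : ℂ) (N : ℕ) (B : TwoForm A) : Current A := fun l =>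
  if Even N then
    match l with
    | .main false => if 2 ≤ N then bosonMain bg lam (N / 2) B else 0
    | .trace false => if 4 ≤ N then bosonTrace bg lam (N / 2) B else 0
    | _ => 0
  else if 3 ≤ N then
    match l with
    | .main χ => (1 / ((N : ℂ) / 2 - 1 / 2)) •
        (B.part (pair χ ((N - 1) / 2) ((N - 3) / 2))).at (!χ) .y .y
    | .trace χ => (-(1 / ((N : ℂ) / 2 + 1 / 2))) •
        (B.part (pair χ ((N - 1) / 2) ((N - 3) / 2))).at χ .p .p
    | .gammaTrace χ => (-(Complex.I * (((N : ℂ) / 2) ^ 2 - 1 / 4) / N)) •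
        ((((N : ℂ) / 2 + 1 / 2)) • (B.part (pair χ ((N - 1) / 2) ((N - 3) / 2))).at χ .y .p +
          (((N : ℂ) / 2 - 1 / 2)) • (B.part (pair χ ((N - 1) / 2) ((N - 3) / 2))).at (!χ) .y .p)
  else 0

/-- The current of the Klein-Gordon (`N = 0`), Dirac (`N = 1`) and Yang-Mills (`N = 2`) equations
determined by the right-hand side `w` of the equation for the zero-form `C`:
`J_{0,0} = - (i Υ_{1,1}(p,p̄|Y) - D(p,p̄) Υ_{0,0}(y,ȳ|0)) / 2`;
`J_{1,0} = Υ_{0,1}(y,p̄|0,ȳ)` and its conjugate; `J_{1,1} = - η Υ_{0,2}(y,p̄|0,ȳ) / 4 + c.c.` -/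
def currentZero (bg : Background) (η lam : ℂ) (N : ℕ) (w : OneForm A) : Current A := fun l =>
  match N, l with
  | 0, .main false => (-1 / 2 : ℂ) • (Complex.I • (w.part (pair true 1 1)).at true .p .p -
      bg.D lam true .p .p ((w.part (pair true 0 0)).at true .y .y))
  | 1, .main χ => (w.part (pair χ 0 1)).at χ .y .p
  | 2, .main false => ∑ χ, (-(coupling η χ) / 4) • (w.part (pair χ 0 2)).at χ .y .p
  | _, _ => 0

/-! ### Counting of derivatives -/

/-- `J`, as a function of the parameter `lam` multiplying each space-time derivative, is a
polynomial all of whose powers of `lam` lie in `T`: every term of the current carries a number of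
derivatives that belongs to `T`. If `T` is empty, the current vanishes. -/
def Carries (J : ℂ → Current A) (T : Set ℕ) : Prop :=
  ∃ c : ℕ →₀ Current A, (∀ k ∈ c.support, k ∈ T) ∧
    ∀ lam : ℂ, J lam = ∑ k ∈ c.support, lam ^ k • c k

/-- The spin `N / 2`. -/
def spin (N : ℕ) : ℚ := N / 2

/-- `𝒮 = [s₁] + [s₂] + [s₃]`. -/
def sumS (N₁ N₂ N₃ : ℕ) : ℚ := ((N₁ / 2 + N₂ / 2 + N₃ / 2 : ℕ) : ℚ)

/-- The triangle inequalities `s_i + s_j ≥ s_k + 1`. -/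
def Triangle (s₁ s₂ s₃ : ℚ) : Prop :=
  s₃ + 1 ≤ s₁ + s₂ ∧ s₂ + 1 ≤ s₁ + s₃ ∧ s₁ + 1 ≤ s₂ + s₃

/-! ### The tables

`s_i = N_i / 2`; `s₁` is the spin of the vertex and `s₂`, `s₃` are the spins of its first and second
factor. `τ₂`, `τ₃` are the signs of the helicities of the factors. -/

/-- Numbers of derivatives allowed for `Υ(ω, ω)`. -/
def tableWW (N₁ N₂ N₃ : ℕ) (τ₂ τ₃ : Bool) : Set ℕ :=
  {k | Triangle (spin N₁) (spin N₂) (spin N₃) ∧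
    (k : ℚ) ≤ if τ₂ = τ₃ then sumS N₁ N₂ N₃ - 2 * spin N₁
      else sumS N₁ N₂ N₃ - 2 * max (spin N₂) (spin N₃)}

/-- Numbers of derivatives allowed for `Υ(Ω, ω, C)`. -/
def tableWC (N₁ N₂ N₃ : ℕ) (τ₂ τ₃ : Bool) : Set ℕ :=
  {k |
    (Triangle (spin N₁) (spin N₂) (spin N₃) ∧
      (k : ℚ) ≤ sumS N₁ N₂ N₃ - 2 * min (spin N₁) (min (spin N₂) (spin N₃))) ∨
    (spin N₂ = spin N₁ + spin N₃ ∧ (k : ℚ) ≤ sumS N₁ N₂ N₃ - 2 * min (spin N₁) (spin N₃)) ∨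
    (spin N₃ = spin N₁ + spin N₂ ∧ (k : ℚ) ≤ sumS N₁ N₂ N₃ - 2 * min (spin N₁) (spin N₂)) ∨
    (spin N₁ + spin N₃ < spin N₂ ∧ (k : ℚ) ≤ if τ₂ = τ₃ then sumS N₁ N₂ N₃
      else sumS N₁ N₂ N₃ - 2 * min (spin N₁) (spin N₃)) ∨
    (spin N₁ + spin N₂ < spin N₃ ∧ (k : ℚ) ≤ if τ₂ = τ₃ then sumS N₁ N₂ N₃
      else sumS N₁ N₂ N₃ - 2 * min (spin N₁) (spin N₂))}

/-- Numbers of derivatives allowed for `Υ(Ω, Ω, C, C)`. -/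
def tableCC (N₁ N₂ N₃ : ℕ) (τ₂ τ₃ : Bool) : Set ℕ :=
  {k |
    (τ₂ = τ₃ ∧
      (Triangle (spin N₁) (spin N₂) (spin N₃) ∨ spin N₂ = spin N₁ + spin N₃ ∨
        spin N₃ = spin N₁ + spin N₂ ∨ spin N₂ + spin N₃ ≤ spin N₁) ∧
      (k : ℚ) = sumS N₁ N₂ N₃) ∨
    (τ₂ ≠ τ₃ ∧ spin N₂ + spin N₃ ≤ spin N₁ ∧
      (k : ℚ) = sumS N₁ N₂ N₃ - 2 * min (spin N₂) (spin N₃))}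

/-- Numbers of derivatives allowed for `Υ(ω, C)`, where `C` is the field of spin `N / 2`.
If `s₁ = 1` and `C` has spin `0` or `1/2`, terms with `𝒮 - 2` derivatives occur as well. -/
def table0WC (N₁ N₂ N₃ N : ℕ) : Set ℕ :=
  {k |
    ((N₁ = 1 ∨ N₁ = 2) ∧ spin N₁ + 1 ≤ spin N₂ + spin N₃ ∧
      ((k : ℚ) = sumS N₁ N₂ N₃ - 2 * min (spin N₁) (min (spin N₂) (spin N₃)) ∨
        (N₁ = 2 ∧ spin N < 1 ∧ (k : ℚ) = sumS N₁ N₂ N₃ - 2))) ∨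
    ((N₁ = 0 ∨ N₁ = 1 ∨ N₁ = 2) ∧ spin N₁ + 1 ≤ |spin N₂ - spin N₃| ∧
      (k : ℚ) = sumS N₁ N₂ N₃)}

/-- Numbers of derivatives allowed for `Υ(Ω, C, C)`. -/
def table0CC (N₁ N₂ N₃ : ℕ) : Set ℕ :=
  {k |
    ((N₁ = 1 ∨ N₁ = 2) ∧ spin N₂ + spin N₃ ≤ spin N₁ ∧
      (k : ℚ) = sumS N₁ N₂ N₃ - 2 * min (spin N₁) (min (spin N₂) (spin N₃))) ∨
    ((N₁ = 1 ∨ N₁ = 2) ∧ |spin N₂ - spin N₃| ≤ spin N₁ ∧ (k : ℚ) = sumS N₁ N₂ N₃) ∨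
    (N₁ = 0 ∧ |spin N₂ - spin N₃| ≤ 1 ∧ 1 ≤ spin N₂ + spin N₃ ∧
      (k : ℚ) = ((N₂ / 2 + N₃ / 2 : ℕ) : ℚ))}

end

end HigherSpin

open HigherSpin

/-!
A monomial of a vertex kernel has degrees in `Y`, `P₁` and `P₂` that are fixed by the contractions
it is built from. Each contraction joins two of the three, and prefactors contribute given degrees,
so a nonzero contribution of bidegrees `a` and `b` of the factors to bidegree `m` forces linear
(in)equalities and parity conditions on `m`, `a`, `b`. On the other side, a component of bidegree
`a` of `ω` or `C` contains a number of derivatives of the Fronsdal field that is determined by `a`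
alone. The number of derivatives of every term is thus a function of bidegrees constrained by
linear relations, and the comparison with the tables is integer arithmetic.

Two cancellations sharpen this count. In `Υ(Ω, Ω, C, C)` the terms of the current with an operator
`p` vanish, because this operator contracts `t₂ p₁ - t₁ p₂` with itself. In `Υ(ω, C)` the
contraction of `p` with the index of the one-form `ω = -h(p, p̄) φ` cancels where `p` hits `ω`, so
that only the derivative of `C` remains.
-/

namespace HigherSpin

open scoped ContDiff

noncomputable section

variable {A : Type*} [NormedRing A] [NormedAlgebra ℂ A]

/-! ### Polynomials in the derivative-counting parameter -/

section PowersIn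

variable {R M M' : Type*} [CommSemiring R] [AddCommMonoid M] [Module R M]
  [AddCommMonoid M'] [Module R M'] {T : Set ℕ}

/-- The functions `J : R → M` that are polynomials `J r = ∑ₖ r ^ k • c k` with coefficients in `M`
and all exponents `k` in `T`. -/
def powersIn (T : Set ℕ) : Submodule R (R → M) :=
  (Finsupp.supported M R T).map
    (Finsupp.lsum R fun k => LinearMap.pi fun r : R => r ^ k • LinearMap.id)

theorem mem_powersIn_iff {J : R → M} : J ∈ powersIn T ↔
    ∃ c : ℕ →₀ M, (∀ k ∈ c.support, k ∈ T) ∧ ∀ r, J r = ∑ k ∈ c.support, r ^ k • c k := by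
  simp only [powersIn, Submodule.mem_map, Finsupp.mem_supported, Finsupp.lsum_apply, Finsupp.sum,
    Set.subset_def, SetLike.mem_coe, funext_iff, Finset.sum_apply, LinearMap.pi_apply,
    LinearMap.smul_apply, LinearMap.id_apply, eq_comm]

theorem carries_iff_mem_powersIn {J : ℂ → Current A} : Carries J T ↔ J ∈ powersIn T :=
  mem_powersIn_iff.symm

theorem powersIn_mono {T' : Set ℕ} (h : T ⊆ T') :
    (powersIn T : Submodule R (R → M)) ≤ powersIn T' :=
  Submodule.map_mono (Finsupp.supported_mono h)

theorem pow_smul_mem_powersIn {k : ℕ} (x : M) (h : x ≠ 0 → k ∈ T) :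
    (fun r : R => r ^ k • x) ∈ powersIn T := by
  obtain rfl | hx := eq_or_ne x 0
  · simp only [smul_zero]
    exact (powersIn T).zero_mem
  · refine ⟨Finsupp.single k x, Finsupp.single_mem_supported R x (h hx), ?_⟩
    ext r
    simp only [Finsupp.lsum_single, LinearMap.pi_apply, LinearMap.smul_apply, LinearMap.id_apply]

theorem sum_mem_powersIn {ι : Type*} {s : Finset ι} {J : ι → R → M}
    (h : ∀ i ∈ s, J i ∈ powersIn T) : (fun r => ∑ i ∈ s, J i r) ∈ powersIn T := by
  simpa only [← Finset.sum_apply] using sum_mem h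

theorem map_mem_powersIn (L : M →ₗ[R] M') {J : R → M} (h : J ∈ powersIn T) :
    (fun r => L (J r)) ∈ powersIn T := by
  obtain ⟨c, hc, hJ⟩ := mem_powersIn_iff.1 h
  simp only [hJ, map_sum, map_smul]
  exact sum_mem_powersIn fun k hk => pow_smul_mem_powersIn _ fun _ => hc k hk

theorem param_smul_mem_powersIn {J : R → M} (h : J ∈ powersIn {k | k + 1 ∈ T}) :
    (fun r => r • J r) ∈ powersIn T := by
  obtain ⟨c, hc, hJ⟩ := mem_powersIn_iff.1 h
  simp only [hJ, Finset.smul_sum, smul_smul, ← pow_succ']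
  exact sum_mem_powersIn fun k hk => pow_smul_mem_powersIn _ fun _ => hc k hk

theorem pi_mem_powersIn {ι : Type*} [Finite ι] {V : ι → Type*} [∀ i, AddCommMonoid (V i)]
    [∀ i, Module R (V i)] {J : R → ∀ i, V i} (h : ∀ i, (fun r => J r i) ∈ powersIn T) :
    J ∈ powersIn T := by
  classical
  cases nonempty_fintype ι
  rw [show J = fun r => ∑ i, LinearMap.single R V i (J r i) from
    funext fun r => (Finset.univ_sum_single (J r)).symm]
  exact sum_mem_powersIn fun i _ => map_mem_powersIn (LinearMap.single R V i) (h i)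

end PowersIn

instance : Finite CurrentLabel := by
  refine Finite.of_surjective (fun x : Fin 3 × Bool =>
    ![CurrentLabel.main x.2, .trace x.2, .gammaTrace x.2] x.1) ?_
  rintro (χ | χ | χ)
  exacts [⟨(0, χ), rfl⟩, ⟨(1, χ), rfl⟩, ⟨(2, χ), rfl⟩]

/-! ### Operators on generating functions as linear maps -/

/-- The operator `comp m` as a linear map. -/
def compₗ (m : Bool → ℕ) : Module.End ℂ (Gen A) where
  toFun := comp m
  map_add' f g := by ext1 μ; simp only [comp, Pi.add_apply, ite_add_zero]
  map_smul' c f := by ext1 μ; simp only [comp, Pi.smul_apply, smul_ite, smul_zero, RingHom.id_apply]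

/-- The operator `mulK χ` as a linear map. -/
def mulKₗ (χ : Bool) : Module.End ℂ (Gen A) where
  toFun := mulK χ
  map_add' _ _ := rfl
  map_smul' _ _ := rfl

/-- The operator `pdY v` as a linear map. -/
def pdYₗ (v : Var) : Module.End ℂ (Gen A) where
  toFun := pdY v
  map_add' f g := by ext1 μ; simp only [pdY, Pi.add_apply, smul_add]
  map_smul' c f := by ext1 μ; simp only [pdY, Pi.smul_apply, RingHom.id_apply, smul_comm c]

/-- The operator `mulY v` as a linear map. -/
def mulYₗ (v : Var) : Module.End ℂ (Gen A) where
  toFun := mulY v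
  map_add' f g := by
    ext1 μ; simp only [mulY, Pi.add_apply]; split_ifs <;> simp only [add_zero]
  map_smul' c f := by
    ext1 μ; simp only [mulY, Pi.smul_apply, smul_ite, smul_zero, RingHom.id_apply]

/-- The operator `s.act χ a` as a linear map. -/
def Slot.actₗ (s : Slot) (χ : Bool) (a : Fin 2) : Module.End ℂ (Gen A) :=
  match s with
  | .y => mulYₗ (χ, a)
  | .p => ∑ b, (eps a b * (-Complex.I)) • pdYₗ (χ, b)

theorem Slot.actₗ_apply (s : Slot) (χ : Bool) (a : Fin 2) (f : Gen A) :
    s.actₗ χ a f = s.act χ a f := by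
  cases s
  · rfl
  · simp only [actₗ, act, LinearMap.sum_apply, LinearMap.smul_apply]
    rfl

/-- The operator `scalG g` as a linear map. -/
def scalGₗ (g : SmoothFun ℂ) : Module.End ℂ (Gen A) where
  toFun := scalG g
  map_add' f f' := by ext μ κ x; exact smul_add (g.1 x) (f μ κ |>.1 x) (f' μ κ |>.1 x)
  map_smul' c f := by ext μ κ x; exact smul_comm (g.1 x) c (f μ κ |>.1 x)

theorem differentiableAt_smoothFun (f : SmoothFun A) (x : SpaceTime) :
    DifferentiableAt ℝ f.1 x :=
  (show ContDiff ℝ ∞ f.1 from f.2).differentiable (by simp) x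

/-- The derivative `pdX n` as a linear map. -/
def pdXₗ (n : Fin 4) : Module.End ℂ (SmoothFun A) where
  toFun := pdX n
  map_add' f g := by
    ext x
    exact DFunLike.congr_fun
      (fderiv_add (differentiableAt_smoothFun f x) (differentiableAt_smoothFun g x)) _
  map_smul' c f := by
    ext x
    exact DFunLike.congr_fun (fderiv_const_smul (differentiableAt_smoothFun f x) c) _

/-- The Lorentz covariant derivative `bg.lorentz n` as a linear map. -/
def Background.lorentzₗ (bg : Background) (n : Fin 4) : Module.End ℂ (Gen A) :=
  LinearMap.pi (fun μ => LinearMap.pi fun κ =>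
      pdXₗ n ∘ₗ LinearMap.proj κ ∘ₗ LinearMap.proj (φ := fun _ : Expo => Klein → SmoothFun A) μ) +
    ∑ χ, ∑ a, ∑ b, Complex.I • (scalGₗ (bg.conn n χ a b) ∘ₗ Slot.y.actₗ χ a ∘ₗ Slot.p.actₗ χ b)

theorem Background.lorentzₗ_apply (bg : Background) (n : Fin 4) (f : Gen A) :
    bg.lorentzₗ n f = bg.lorentz n f := by
  simp only [lorentzₗ, LinearMap.add_apply, LinearMap.sum_apply, LinearMap.smul_apply,
    LinearMap.comp_apply, Slot.actₗ_apply]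
  rfl

/-- The frame derivative `bg.covD ι` as a linear map. -/
def Background.covDₗ (bg : Background) (ι : Bool → Fin 2) : Module.End ℂ (Gen A) :=
  ∑ n, scalGₗ (bg.e n ι) ∘ₗ bg.lorentzₗ n

theorem Background.covDₗ_apply (bg : Background) (ι : Bool → Fin 2) (f : Gen A) :
    bg.covDₗ ι f = bg.covD ι f := by
  simp only [covDₗ, LinearMap.sum_apply, LinearMap.comp_apply, lorentzₗ_apply]
  rfl

/-- The operator `D(u, ū)` without the derivative-counting parameter, as a linear map. -/
def Background.Dₗ (bg : Background) (χ : Bool) (u v : Slot) : Module.End ℂ (Gen A) :=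
  ∑ a, ∑ b, u.actₗ χ a ∘ₗ v.actₗ (!χ) b ∘ₗ bg.covDₗ (pair χ a b)

theorem Background.D_eq_smul_Dₗ (bg : Background) (lam : ℂ) (χ : Bool) (u v : Slot) :
    (bg.D lam χ u v : Gen A → Gen A) = ⇑(lam • bg.Dₗ χ u v) := by
  ext1 f
  simp only [D, Dₗ, LinearMap.sum_apply, LinearMap.smul_apply, LinearMap.comp_apply,
    Slot.actₗ_apply, covDₗ_apply]

theorem Background.D_iterate (bg : Background) (lam : ℂ) (χ : Bool) (u v : Slot) (n : ℕ)
    (f : Gen A) : (bg.D lam χ u v)^[n] f = lam ^ n • (bg.Dₗ χ u v ^ n) f := by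
  rw [D_eq_smul_Dₗ, ← Module.End.coe_pow, smul_pow, LinearMap.smul_apply]

theorem Background.D_mem_powersIn (bg : Background) (χ : Bool) (u v : Slot) {T : Set ℕ}
    {J : ℂ → Gen A} (h : J ∈ powersIn {k | k + 1 ∈ T}) :
    (fun lam => bg.D lam χ u v (J lam)) ∈ powersIn T := by
  simpa only [D_eq_smul_Dₗ, LinearMap.smul_apply] using
    param_smul_mem_powersIn (map_mem_powersIn (bg.Dₗ χ u v) h)

/-! ### Fields homogeneous in the parameter -/

/-- The bidegree of the monomial with exponent `μ`: its degrees in the undotted (`true`) and in the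
dotted (`false`) variables. -/
def bideg (μ : Expo) : Bool → ℕ := fun χ => deg χ μ

/-- A family of fields depending on the derivative-counting parameter: the coefficient of a monomial
of bidegree `a` in `f lam` is proportional to `lam ^ d a`, and vanishes unless `P a`. -/
structure Graded (f : ℂ → Gen A) (d : (Bool → ℕ) → ℕ) (P : (Bool → ℕ) → Prop) : Prop where
  eq_smul : ∀ lam μ, f lam μ = lam ^ d (bideg μ) • f 1 μ
  support : ∀ lam μ, f lam μ ≠ 0 → P (bideg μ)

section Graded

variable {f : ℂ → Gen A} {d : (Bool → ℕ) → ℕ} {P : (Bool → ℕ) → Prop}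

theorem Graded.helPart (h : Graded f d P) (τ : Bool) :
    Graded (fun lam => helPart τ (f lam)) d fun a => P a ∧ a (!τ) ≤ a τ where
  eq_smul lam μ := by
    simp only [HigherSpin.helPart, smul_ite, smul_zero, h.eq_smul lam μ]
  support lam μ hμ := by
    obtain ⟨hτ, hf⟩ := ite_ne_right_iff.1 hμ
    exact ⟨h.support lam μ hf, hτ⟩

theorem Graded.reflect (h : Graded f d P) : Graded (fun lam => reflect (f lam)) d P where
  eq_smul lam μ := by simp only [HigherSpin.reflect, h.eq_smul lam μ, smul_comm (lam ^ _)]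
  support lam μ hμ := h.support lam μ (right_ne_zero_of_smul hμ)

end Graded

/-- The number of derivatives in the component of bidegree `a` of a gauge one-form. -/
def gaugeOrder (a : Bool → ℕ) : ℕ := ((a true - a false) + (a false - a true)) / 2

/-- The number of derivatives in the component of bidegree `a` of a zero-form of spin `N / 2`. -/
def weylOrder (N : ℕ) (a : Bool → ℕ) : ℕ := N / 2 + min (a true) (a false)

/-- The bidegrees of the components of a gauge one-form of spin `N / 2`. -/
def GaugeDeg (N : ℕ) (a : Bool → ℕ) : Prop := a true + a false + 2 = N

/-- The bidegrees of the components of a zero-form of spin `N / 2`. -/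
def WeylDeg (N : ℕ) (a : Bool → ℕ) : Prop := a true = N + a false ∨ a false = N + a true

section FronsdalField

variable {N : ℕ} (Φ : FronsdalField A N) (bg : Background) (co : Coefficients)

theorem tower_eq_smul (lam : ℂ) (χ : Bool) (m : ℕ) :
    Φ.tower bg lam co χ m = lam ^ m • Φ.tower bg 1 co χ m := by
  simp only [FronsdalField.tower, Background.D_iterate, one_pow, one_smul, smul_comm (lam ^ m)]

theorem pdY_smul (v : Var) (c : ℂ) (f : Gen A) : pdY v (c • f) = c • pdY v f :=
  (pdYₗ v).map_smul c f

theorem graded_omega (ι : Bool → Fin 2) :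
    Graded (fun lam => Φ.omega bg lam co ι) gaugeOrder (GaugeDeg N) where
  eq_smul lam μ := by
    simp only [FronsdalField.omega, tower_eq_smul Φ bg co lam, pdY_smul, Pi.smul_apply, smul_ite,
      smul_zero, gaugeOrder, bideg]
    split_ifs
    · congr 2; omega
    · congr 2; omega
    · rfl
  support lam μ h := (ite_ne_right_iff.1 h).1

theorem weylComp_eq_smul (lam : ℂ) (χ : Bool) (n : ℕ) :
    Φ.weylComp bg lam co χ n = lam ^ (N / 2 + n) • Φ.weylComp bg 1 co χ n := by
  have mulK_smul (c : ℂ) (f : Gen A) : mulK (!χ) (c • f) = c • mulK (!χ) f := rfl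
  simp only [FronsdalField.weylComp, Background.D_iterate, map_smul, mulK_smul, one_pow, one_smul,
    smul_smul]
  ring_nf

theorem graded_weyl : Graded (fun lam => Φ.weyl bg lam co) (weylOrder N) (WeylDeg N) where
  eq_smul lam μ := by
    simp only [FronsdalField.weyl, weylComp_eq_smul Φ bg co lam, Pi.smul_apply, smul_ite, smul_zero,
      weylOrder, bideg]
    split_ifs
    · congr 2; omega
    · congr 2; omega
    · rfl
  support lam μ h := by
    simp only [FronsdalField.weyl] at h
    split_ifs at h with h₁ h₂
    exacts [.inl h₁, .inr h₂, absurd rfl h]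

theorem graded_omega_hel (τ : Bool) (ι : Bool → Fin 2) :
    Graded (fun lam => (Φ.omega bg lam co).hel τ ι) gaugeOrder
      fun a => GaugeDeg N a ∧ a (!τ) ≤ a τ :=
  (graded_omega Φ bg co ι).helPart τ

end FronsdalField

/-! ### Degrees of the monomials of a kernel -/

/-- Degrees of a monomial in `Y`, `P₁`, `P₂`: leg and chirality. -/
abbrev LegDeg := Fin 3 → Bool → ℕ

/-- The degrees of the monomial with exponent `d`. -/
def legDeg (d : Fin 3 × Var →₀ ℕ) : LegDeg := fun i χ => ∑ a, d (i, (χ, a))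

/-- The degrees of a single variable of leg `i` and chirality `χ`. -/
def unitDeg (i : Fin 3) (χ : Bool) : LegDeg := fun j c => if j = i ∧ c = χ then 1 else 0

theorem legDeg_add (d e : Fin 3 × Var →₀ ℕ) : legDeg (d + e) = legDeg d + legDeg e := by
  funext i χ
  simp only [legDeg, Finsupp.add_apply, Finset.sum_add_distrib, Pi.add_apply]

theorem legDeg_single (i : Fin 3) (χ : Bool) (a : Fin 2) :
    legDeg (Finsupp.single (i, (χ, a)) 1) = unitDeg i χ := by
  funext j c
  by_cases hj : j = i ∧ c = χ
  · obtain ⟨rfl, rfl⟩ := hj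
    simp [legDeg, unitDeg, Finsupp.single_apply]
  · rw [legDeg, Finset.sum_eq_zero fun b _ => Finsupp.single_eq_of_ne (by grind), unitDeg,
      if_neg hj]

theorem legDeg_joinExpo (μ ν ρ : Expo) :
    legDeg (joinExpo μ ν ρ) = ![bideg μ, bideg ν, bideg ρ] := by
  funext i χ
  fin_cases i <;> rfl

/-- The polynomials such that multiplication by their monomials takes degrees satisfying `Q` to
degrees satisfying `R`. -/
def degMap (Q R : LegDeg → Prop) : Submodule ℂ Sym :=
  MvPolynomial.restrictSupport ℂ {e | ∀ v, Q v → R (v + legDeg e)}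

section DegMap

variable {Q R S : LegDeg → Prop} {p q : Sym} {i j : Fin 3} {χ : Bool}

theorem degMap_mul_mem (hp : p ∈ degMap Q R) (hq : q ∈ degMap R S) : p * q ∈ degMap Q S := by
  classical
  intro e he
  obtain ⟨x, hx, y, hy, rfl⟩ := Finset.mem_add.1 (MvPolynomial.support_mul p q he)
  intro v hv
  rw [legDeg_add, ← add_assoc]
  exact hq hy _ (hp hx v hv)

theorem one_mem_degMap (h : ∀ v, Q v → R v) : 1 ∈ degMap Q R := by
  refine (MvPolynomial.monomial_mem_restrictSupport ℂ).2 (.inl fun v hv => ?_)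
  exact h v hv

theorem C_mul_mem_degMap (c : ℂ) (hp : p ∈ degMap Q R) : MvPolynomial.C c * p ∈ degMap Q R := by
  rw [MvPolynomial.C_mul']
  exact Submodule.smul_mem _ c hp

theorem pow_mem_degMap (h : p ∈ degMap Q Q) (n : ℕ) : p ^ n ∈ degMap Q Q := by
  induction n with
  | zero => exact pow_zero p ▸ one_mem_degMap fun _ => id
  | succ n ih => exact pow_succ p n ▸ degMap_mul_mem ih h

theorem leg_mem_degMap (a : Fin 2) (h : ∀ v, Q v → R (v + unitDeg i χ)) :
    leg i χ a ∈ degMap Q R := by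
  refine (MvPolynomial.monomial_mem_restrictSupport ℂ).2 (.inl fun v hv => ?_)
  rw [legDeg_single]
  exact h v hv

theorem py_mem_degMap (h : ∀ v, Q v → R (v + unitDeg i χ + unitDeg 0 χ)) :
    py χ i ∈ degMap Q R :=
  sum_mem fun a _ => degMap_mul_mem (R := fun v => R (v + unitDeg 0 χ)) (leg_mem_degMap a h)
    (leg_mem_degMap a fun _ => id)

theorem pp_mem_degMap (h : ∀ v, Q v → R (v + unitDeg i χ + unitDeg j χ)) :
    pp χ i j ∈ degMap Q R :=
  sum_mem fun a _ => sum_mem fun b _ =>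
    degMap_mul_mem (R := fun v => R (v + unitDeg j χ)) (C_mul_mem_degMap _ (leg_mem_degMap a h))
      (leg_mem_degMap b fun _ => id)

theorem expKernel_support {G : Sym} (hG : G ∈ degMap (· = 0) Q) (hq : q ∈ degMap Q Q)
    {μ ν ρ : Expo} (h : expKernel G q μ ν ρ ≠ 0) : Q ![bideg μ, bideg ν, bideg ρ] := by
  obtain ⟨n, -, hn⟩ := Finset.exists_ne_zero_of_sum_ne_zero h
  have hcoeff : joinExpo μ ν ρ ∈ (G * q ^ n).support :=
    MvPolynomial.mem_support_iff.2 (div_ne_zero_iff.1 hn).1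
  simpa only [zero_add, legDeg_joinExpo] using
    degMap_mul_mem hG (pow_mem_degMap hq n) hcoeff 0 rfl

end DegMap

/-- The exponent of the star product. -/
def starExponent : Sym := ∑ χ, MvPolynomial.C Complex.I * (-pp χ 1 2 + py χ 1 + py χ 2)

theorem starKernel_eq : starKernel = expKernel 1 starExponent := rfl

/-- Legs `w`, `c` are the two factors. -/
def Legs (w c : Fin 3) : Prop := (w = 1 ∧ c = 2) ∨ (w = 2 ∧ c = 1)

/-- Degrees in the star product kernel multiplied by `s χ` factors `p_c` of each chirality. -/
def StarRel (s : Bool → ℕ) (w c : Fin 3) (v : LegDeg) : Prop :=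
  ∀ χ, v 0 χ + s χ ≤ v w χ + v c χ ∧ v w χ + s χ ≤ v 0 χ + v c χ ∧
    v c χ ≤ v 0 χ + v w χ + s χ ∧ (v 0 χ + v w χ + v c χ + s χ) % 2 = 0

/-- Degrees `a`, `b`, `c` of `Y`, `P₁`, `P₂` in `n` factors `p₁` or `p₂`, multiplied by contractions
`(p₁p₂)`, `(p₁y)`, `(p₂y)`. -/
def ContractionRel (n a b c : ℕ) : Prop :=
  a + n ≤ b + c ∧ b ≤ a + c + n ∧ c ≤ a + b + n ∧ (a + b + c + n) % 2 = 0

/-- Degrees in the kernel of `Υ(Ω, ω, C)`. -/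
def WCRel (χ : Bool) (w c : Fin 3) (v : LegDeg) : Prop :=
  v w χ = v c χ + v 0 χ + 1 ∧ ContractionRel 1 (v 0 (!χ)) (v w (!χ)) (v c (!χ))

/-- Degrees in the kernel of `Υ(Ω, Ω, C, C)`. -/
def CCRel (χ : Bool) (v : LegDeg) : Prop :=
  v 0 χ = v 1 χ + v 2 χ ∧ ContractionRel 2 (v 0 (!χ)) (v 1 (!χ)) (v 2 (!χ))

/-- Degrees in the kernel of `Υ(Ω, C, C)`. -/
def ZeroCCRel (χ : Bool) (v : LegDeg) : Prop :=
  v 0 χ = v 1 χ + v 2 χ + 1 ∧ ContractionRel 1 (v 0 (!χ)) (v 1 (!χ)) (v 2 (!χ))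

theorem starExponent_mem_degMap (s : Bool → ℕ) {w c : Fin 3} (h : Legs w c) :
    starExponent ∈ degMap (StarRel s w c) (StarRel s w c) := by
  refine sum_mem fun χ _ => C_mul_mem_degMap _ (add_mem (add_mem (neg_mem (pp_mem_degMap ?_))
    (py_mem_degMap ?_)) (py_mem_degMap ?_)) <;>
  · intro v hv c
    have := hv c
    simp only [unitDeg, Pi.add_apply]
    grind [Legs]

theorem starKernel_support {w c : Fin 3} (h : Legs w c) {μ ν ρ : Expo}
    (hF : starKernel μ ν ρ ≠ 0) : StarRel 0 w c ![bideg μ, bideg ν, bideg ρ] := by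
  refine expKernel_support (one_mem_degMap ?_) (starExponent_mem_degMap 0 h) hF
  rintro v rfl χ
  simp

theorem exists_ne_zero_of_intervalIntegral_ne_zero {E : Type*} [NormedAddCommGroup E]
    [NormedSpace ℝ E] {f : ℝ → E} {a b : ℝ} (h : ∫ t in a..b, f t ≠ 0) : ∃ t, f t ≠ 0 := by
  by_contra! h0
  exact h (by simp only [h0, intervalIntegral.integral_zero])

theorem kernelWC_support {χ : Bool} {w c : Fin 3} (h : Legs w c) {σ : ℂ} {ι : Bool → Fin 2}
    {μ ν ρ : Expo} (hF : kernelWC χ w c σ ι μ ν ρ ≠ 0) :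
    WCRel χ w c ![bideg μ, bideg ν, bideg ρ] := by
  obtain ⟨t, ht⟩ := exists_ne_zero_of_intervalIntegral_ne_zero hF
  refine expKernel_support ?_ ?_ ht
  · refine degMap_mul_mem (R := (· = unitDeg w χ)) (leg_mem_degMap _ ?_) <| add_mem
      (C_mul_mem_degMap _ (leg_mem_degMap _ ?_)) (leg_mem_degMap _ ?_) <;> rintro v rfl
    · exact zero_add _
    all_goals
      simp only [WCRel, ContractionRel, unitDeg, Pi.add_apply]
      grind [Legs]
  · refine add_mem (add_mem (sub_mem (add_mem (C_mul_mem_degMap _ (pp_mem_degMap ?_))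
      (C_mul_mem_degMap _ (py_mem_degMap ?_))) (C_mul_mem_degMap _ (pp_mem_degMap ?_)))
      (C_mul_mem_degMap _ (py_mem_degMap ?_))) (C_mul_mem_degMap _ (py_mem_degMap ?_)) <;>
    · intro v hv
      simp only [WCRel, ContractionRel, unitDeg, Pi.add_apply] at hv ⊢
      grind [Legs]

theorem kernelCCAux_support {χ : Bool} {a b : Fin 2} {t₁ t₂ t₃ t₄ : ℝ} {μ ν ρ : Expo}
    (hF : kernelCCAux χ a b t₁ t₂ t₃ t₄ μ ν ρ ≠ 0) :
    CCRel χ ![bideg μ, bideg ν, bideg ρ] := by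
  refine expKernel_support ?_ ?_ hF
  · refine degMap_mul_mem (R := fun v => v = unitDeg 1 (!χ) ∨ v = unitDeg 2 (!χ))
      (sub_mem (C_mul_mem_degMap _ (leg_mem_degMap _ ?_))
        (C_mul_mem_degMap _ (leg_mem_degMap _ ?_)))
      (sub_mem (C_mul_mem_degMap _ (leg_mem_degMap _ ?_))
        (C_mul_mem_degMap _ (leg_mem_degMap _ ?_)))
    · rintro v rfl
      exact .inl (zero_add _)
    · rintro v rfl
      exact .inr (zero_add _)
    all_goals
      rintro v (rfl | rfl) <;>
      · simp only [CCRel, ContractionRel, unitDeg, Pi.add_apply]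
        grind
  · refine sub_mem (add_mem (sub_mem (sub_mem (C_mul_mem_degMap _ (py_mem_degMap ?_))
      (C_mul_mem_degMap _ (py_mem_degMap ?_))) (C_mul_mem_degMap _ (pp_mem_degMap ?_)))
      (C_mul_mem_degMap _ (py_mem_degMap ?_))) (C_mul_mem_degMap _ (py_mem_degMap ?_)) <;>
    · intro v hv
      simp only [CCRel, ContractionRel, unitDeg, Pi.add_apply] at hv ⊢
      grind

theorem kernelCC_support {χ : Bool} {a b : Fin 2} {μ ν ρ : Expo}
    (hF : kernelCC χ a b μ ν ρ ≠ 0) : CCRel χ ![bideg μ, bideg ν, bideg ρ] := by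
  by_contra hn
  have h0 (t₁ t₂ t₃ t₄ : ℝ) : kernelCCAux χ a b t₁ t₂ t₃ t₄ μ ν ρ = 0 :=
    of_not_not fun ht => hn (kernelCCAux_support ht)
  exact hF (by simp only [kernelCC, h0, intervalIntegral.integral_zero, deriv_const])

theorem kernel0CC_support {χ : Bool} {ι : Bool → Fin 2} {μ ν ρ : Expo}
    (hF : kernel0CC χ ι μ ν ρ ≠ 0) : ZeroCCRel χ ![bideg μ, bideg ν, bideg ρ] := by
  obtain ⟨t, ht⟩ := exists_ne_zero_of_intervalIntegral_ne_zero hF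
  refine expKernel_support ?_ ?_ ht
  · refine degMap_mul_mem (R := (· = unitDeg 0 χ))
      (sum_mem fun b _ => C_mul_mem_degMap _ (leg_mem_degMap _ ?_))
      (sub_mem (C_mul_mem_degMap _ (leg_mem_degMap _ ?_))
        (C_mul_mem_degMap _ (leg_mem_degMap _ ?_))) <;> rintro v rfl
    · exact zero_add _
    all_goals
      simp only [ZeroCCRel, ContractionRel, unitDeg, Pi.add_apply]
      grind
  · refine add_mem (add_mem (sub_mem (sub_mem (C_mul_mem_degMap _ (py_mem_degMap ?_))
      (C_mul_mem_degMap _ (py_mem_degMap ?_))) (C_mul_mem_degMap _ (pp_mem_degMap ?_)))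
      (C_mul_mem_degMap _ (py_mem_degMap ?_))) (C_mul_mem_degMap _ (py_mem_degMap ?_)) <;>
    · intro v hv
      simp only [ZeroCCRel, ContractionRel, unitDeg, Pi.add_apply] at hv ⊢
      grind

/-! ### Vertices of homogeneous fields -/

theorem finite_degree_le (B : ℕ) : {μ : Expo | deg true μ + deg false μ ≤ B}.Finite := by
  simpa only [Finsupp.degree_eq_sum, Fintype.sum_prod_type, Fintype.sum_bool, deg] using
    Finsupp.finite_of_degree_le (σ := Var) B

theorem twMul_smul (ρ : Expo) (x y : ℂ) (u v : Klein → SmoothFun A) :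
    twMul ρ (x • u) (y • v) = (x * y) • twMul ρ u v := by
  funext κ
  simp only [twMul, Pi.smul_apply, Finset.smul_sum]
  refine Finset.sum_congr rfl fun κ₁ _ => ?_
  rw [smul_mul_assoc, mul_smul_comm, smul_smul x y, smul_comm]

theorem twMul_zero_left (ρ : Expo) (v : Klein → SmoothFun A) : twMul ρ 0 v = 0 := by
  simpa only [zero_smul, one_smul, zero_mul] using twMul_smul ρ 0 1 0 v

theorem twMul_zero_right (ρ : Expo) (u : Klein → SmoothFun A) : twMul ρ u 0 = 0 := by
  simpa only [zero_smul, one_smul, mul_zero] using twMul_smul ρ 1 0 u 0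

theorem ne_zero_of_apply_term_ne_zero {F : Kernel} {f g : Gen A} {μ : Expo} {p : Expo × Expo}
    (h : (F μ p.1 p.2 * pairing p.1 * pairing p.2) • twMul p.2 (f p.1) (g p.2) ≠ 0) :
    F μ p.1 p.2 ≠ 0 ∧ f p.1 ≠ 0 ∧ g p.2 ≠ 0 := by
  refine ⟨left_ne_zero_of_mul (left_ne_zero_of_mul (left_ne_zero_of_smul h)), fun h0 => ?_,
    fun h0 => ?_⟩ <;> refine right_ne_zero_of_smul h ?_
  · rw [h0, twMul_zero_left]
  · rw [h0, twMul_zero_right]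

section Apply

variable {F : Kernel} {R : LegDeg → Prop} {P P' : (Bool → ℕ) → Prop} {B : ℕ}

theorem apply_eq_sum {f g : Gen A} (hf : ∀ ν, f ν ≠ 0 → P (bideg ν))
    (hg : ∀ ρ, g ρ ≠ 0 → P' (bideg ρ)) {μ : Expo}
    (hF : ∀ ν ρ, F μ ν ρ ≠ 0 → R ![bideg μ, bideg ν, bideg ρ])
    (hB : ∀ a b, R ![bideg μ, a, b] → P a → P' b →
      a true + a false ≤ B ∧ b true + b false ≤ B) :
    F.apply f g μ = ∑ p ∈ ((finite_degree_le B).prod (finite_degree_le B)).toFinset,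
      (F μ p.1 p.2 * pairing p.1 * pairing p.2) • twMul p.2 (f p.1) (g p.2) := by
  refine finsum_eq_sum_of_support_subset _ fun p hp => ?_
  obtain ⟨hFp, hfp, hgp⟩ := ne_zero_of_apply_term_ne_zero hp
  simpa [bideg] using hB _ _ (hF _ _ hFp) (hf _ hfp) (hg _ hgp)

theorem comp_apply_mem_powersIn {f g : ℂ → Gen A} {d e : (Bool → ℕ) → ℕ} (hf : Graded f d P)
    (hg : Graded g e P') (m : Bool → ℕ)
    (hF : ∀ μ ν ρ, F μ ν ρ ≠ 0 → R ![bideg μ, bideg ν, bideg ρ])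
    (hB : ∀ a b, R ![m, a, b] → P a → P' b → a true + a false ≤ B ∧ b true + b false ≤ B)
    {T : Set ℕ} (hT : ∀ a b, R ![m, a, b] → P a → P' b → d a + e b ∈ T) :
    (fun lam => comp m (F.apply (f lam) (g lam))) ∈ powersIn (R := ℂ) T := by
  let term (p : Expo × Expo) : Gen A := comp m fun μ =>
    (F μ p.1 p.2 * pairing p.1 * pairing p.2) • twMul p.2 (f 1 p.1) (g 1 p.2)
  have expansion (lam : ℂ) : comp m (F.apply (f lam) (g lam)) =
      ∑ p ∈ ((finite_degree_le B).prod (finite_degree_le B)).toFinset,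
        lam ^ (d (bideg p.1) + e (bideg p.2)) • term p := by
    funext μ
    simp only [Finset.sum_apply, Pi.smul_apply, term, comp]
    split_ifs with hm
    · obtain rfl : bideg μ = m := funext hm
      rw [apply_eq_sum (hf.support lam) (hg.support lam) (hF μ) hB]
      refine Finset.sum_congr rfl fun p _ => ?_
      rw [hf.eq_smul lam, hg.eq_smul lam, twMul_smul, ← pow_add, smul_comm]
    · simp only [smul_zero, Finset.sum_const_zero]
  simp only [expansion]
  refine sum_mem_powersIn fun p _ => pow_smul_mem_powersIn _ fun hp => ?_
  obtain ⟨μ, hμ⟩ := Function.ne_iff.1 hp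
  simp only [term, comp, Pi.zero_apply, ne_eq, ite_eq_right_iff, Classical.not_imp] at hμ
  obtain rfl : bideg μ = m := funext hμ.1
  obtain ⟨hFp, hfp, hgp⟩ := ne_zero_of_apply_term_ne_zero hμ.2
  exact hT _ _ (hF _ _ _ hFp) (hf.support _ _ hfp) (hg.support _ _ hgp)

end Apply

/-! ### Currents in the one-form sector -/

/-- The contraction `B.at χ u v` as a linear map. -/
def TwoForm.atₗ (χ : Bool) (u v : Slot) : TwoForm A →ₗ[ℂ] Gen A :=
  ∑ a, ∑ b, u.actₗ χ a ∘ₗ v.actₗ χ b ∘ₗ LinearMap.proj b ∘ₗ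
    LinearMap.proj (φ := fun _ : Fin 2 => Fin 2 → Gen A) a ∘ₗ
      LinearMap.proj (φ := fun _ : Bool => Fin 2 → Fin 2 → Gen A) χ

theorem TwoForm.atₗ_apply (B : TwoForm A) (χ : Bool) (u v : Slot) : atₗ χ u v B = B.at χ u v := by
  simp only [atₗ, LinearMap.sum_apply, LinearMap.comp_apply, Slot.actₗ_apply]
  rfl

theorem TwoForm.part_add (B B' : TwoForm A) (m : Bool → ℕ) :
    (B + B').part m = B.part m + B'.part m := by
  ext1 χ; ext1 a; ext1 b
  exact (compₗ m).map_add _ _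

theorem wedge_part_mem_powersIn {W : ℂ → (Bool → Fin 2) → (Bool → Fin 2) → Gen A}
    {m : Bool → ℕ} {T : Set ℕ} (h : ∀ ι ι', (fun lam => comp m (W lam ι ι')) ∈ powersIn T) :
    (fun lam => (wedge (W lam)).part m) ∈ powersIn T := by
  refine pi_mem_powersIn fun χ => pi_mem_powersIn fun a => pi_mem_powersIn fun b => ?_
  have part_wedge (lam : ℂ) : (wedge (W lam)).part m χ a b = ∑ c, ∑ d, (eps c d / 4) •
      (comp m (W lam (pair χ a c) (pair χ b d)) + comp m (W lam (pair χ b c) (pair χ a d))) := by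
    change compₗ m (wedge (W lam) χ a b) = _
    simp only [wedge, map_sum, map_smul, map_add]
    rfl
  simp only [part_wedge]
  exact sum_mem_powersIn fun c _ => sum_mem_powersIn fun d _ =>
    Submodule.smul_mem _ _ (add_mem (h _ _) (h _ _))

/-- The bidegrees of a two-form that enter the Fronsdal current of spin `N / 2`. -/
def CurrentDeg (N : ℕ) (m : Bool → ℕ) : Prop :=
  m true + m false + 2 = N ∧ m true ≤ m false + 2 ∧ m false ≤ m true + 2

/-- The number of derivatives with which the component of bidegree `m` of a two-form enters a
Fronsdal current. -/
def diagOrder (m : Bool → ℕ) : ℕ := if m true = m false then 1 else 0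

/-- The contractions of a family of two-forms that enter the Fronsdal current of spin `N / 2`
contribute to it only with numbers of derivatives in `T`. The contraction with two variables `y`
occurs only for variables of the chirality in which the two-form has the lower degree. -/
def CurrentContractionsIn (N : ℕ) (B : ℂ → TwoForm A) (T : Set ℕ) : Prop :=
  ∀ (m : Bool → ℕ) (c : Bool) (u v : Slot), CurrentDeg N m → (v = .y → u = .y ∧ m c ≤ m (!c)) →
    (fun lam => ((B lam).part m).at c u v) ∈ powersIn {k | k + diagOrder m ∈ T}

section CurrentOne

variable {N : ℕ} {B : ℂ → TwoForm A} {T : Set ℕ} {χ c : Bool} {m n : ℕ} {u v : Slot}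

theorem CurrentContractionsIn.at_mem_of_lt (h : CurrentContractionsIn N B T) (hN : m + n + 2 = N)
    (hlt : n < m) (hle : m ≤ n + 2) (hv : v = .y → u = .y ∧ c = !χ) :
    (fun lam => ((B lam).part (pair χ m n)).at c u v) ∈ powersIn T := by
  have hdeg : CurrentDeg N (pair χ m n) := by
    cases χ <;> simp [CurrentDeg, pair] <;> omega
  have hdiag : diagOrder (pair χ m n) = 0 :=
    if_neg (by cases χ <;> simp [pair] <;> omega)
  simpa only [hdiag, add_zero, Set.ofPred_mem_eq] using h (pair χ m n) c u v hdeg fun hy =>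
    ⟨(hv hy).1, by rw [(hv hy).2]; simpa [pair] using hlt.le⟩

theorem CurrentContractionsIn.at_mem_of_eq (h : CurrentContractionsIn N B T) (hN : m + m + 2 = N)
    (hv : v = .y → u = .y) :
    (fun lam => ((B lam).part (pair χ m m)).at c u v) ∈ powersIn {k | k + 1 ∈ T} := by
  have hdeg : CurrentDeg N (pair χ m m) := by simp [CurrentDeg, pair, hN]
  have hdiag : diagOrder (pair χ m m) = 1 := if_pos (by simp [pair])
  simpa only [hdiag] using h (pair χ m m) c u v hdeg fun hy => ⟨hv hy, by simp [pair]⟩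

variable (bg : Background)

theorem CurrentContractionsIn.bosonMain_mem {s : ℕ} (h : CurrentContractionsIn (s + s) B T)
    (hs : 1 ≤ s) : (fun lam => bosonMain bg lam s (B lam)) ∈ powersIn T := by
  refine sum_mem_powersIn fun χ _ => add_mem ?_ (Submodule.smul_mem _ _
    (add_mem (bg.D_mem_powersIn _ _ _ ?_) (Submodule.smul_mem _ _ (bg.D_mem_powersIn _ _ _ ?_))))
  · split_ifs with h2
    · exact Submodule.smul_mem _ _
        (h.at_mem_of_lt (by omega) (by omega) (by omega) fun _ => ⟨rfl, rfl⟩)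
    · exact zero_mem _
  · exact h.at_mem_of_eq (by omega) fun _ => rfl
  · exact h.at_mem_of_eq (by omega) nofun

theorem CurrentContractionsIn.bosonTrace_mem {s : ℕ} (h : CurrentContractionsIn (s + s) B T)
    (hs : 2 ≤ s) : (fun lam => bosonTrace bg lam s (B lam)) ∈ powersIn T := by
  refine sum_mem_powersIn fun χ _ => add_mem (Submodule.smul_mem _ _ ?_) (Submodule.smul_mem _ _
    (sub_mem (bg.D_mem_powersIn _ _ _ ?_) (Submodule.smul_mem _ _ (bg.D_mem_powersIn _ _ _ ?_))))
  · exact h.at_mem_of_lt (by omega) (by omega) (by omega) nofun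
  · exact h.at_mem_of_eq (by omega) nofun
  · exact h.at_mem_of_eq (by omega) nofun

theorem CurrentContractionsIn.carries_currentOne (h : CurrentContractionsIn N B T) :
    Carries (fun lam => currentOne bg lam N (B lam)) T := by
  refine carries_iff_mem_powersIn.2 (pi_mem_powersIn fun l => ?_)
  have zero_current : (fun _ => 0 : ℂ → Gen A) ∈ powersIn T := zero_mem _
  by_cases hN : Even N
  · simp only [currentOne, if_pos hN]
    obtain ⟨s, rfl⟩ := hN
    rw [show (s + s) / 2 = s by omega]
    rcases l with (_ | _) | (_ | _) | (_ | _)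
    case main.false =>
      by_cases hs : 2 ≤ s + s
      · simpa only [if_pos hs] using h.bosonMain_mem bg (by omega)
      · simpa only [if_neg hs] using zero_current
    case trace.false =>
      by_cases hs : 4 ≤ s + s
      · simpa only [if_pos hs] using h.bosonTrace_mem bg (by omega)
      · simpa only [if_neg hs] using zero_current
    all_goals exact zero_current
  · by_cases h3 : 3 ≤ N
    · simp only [currentOne, if_neg hN, if_pos h3]
      obtain ⟨s, rfl⟩ := Nat.not_even_iff_odd.1 hN
      rcases l with χ | χ | χ
      · exact Submodule.smul_mem _ _
          (h.at_mem_of_lt (by omega) (by omega) (by omega) fun _ => ⟨rfl, rfl⟩)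
      · exact Submodule.smul_mem _ _ (h.at_mem_of_lt (by omega) (by omega) (by omega) nofun)
      · exact Submodule.smul_mem _ _ (add_mem
          (Submodule.smul_mem _ _ (h.at_mem_of_lt (by omega) (by omega) (by omega) nofun))
          (Submodule.smul_mem _ _ (h.at_mem_of_lt (by omega) (by omega) (by omega) nofun)))
    · simpa only [currentOne, if_neg hN, if_neg h3] using zero_current

theorem carries_currentOne_of_part
    (h : ∀ m, CurrentDeg N m → (fun lam => (B lam).part m) ∈ powersIn {k | k + diagOrder m ∈ T}) :
    Carries (fun lam => currentOne bg lam N (B lam)) T :=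
  CurrentContractionsIn.carries_currentOne bg fun m c u v hm _ => by
    simpa only [TwoForm.atₗ_apply] using map_mem_powersIn (TwoForm.atₗ c u v) (h m hm)

end CurrentOne

theorem comp_mulK (m : Bool → ℕ) (χ : Bool) (f : Gen A) :
    comp m (mulK χ f) = mulK χ (comp m f) := by
  ext1 μ; ext1 κ
  simp only [comp, mulK]
  split_ifs <;> rfl

/-! ### The tables in terms of doubled spins -/

section Tables

theorem two_mul_spin (N : ℕ) : 2 * spin N = N :=
  mul_div_cancel₀ (N : ℚ) two_ne_zero

variable {N₁ N₂ N₃ k a b c : ℕ} {τ₂ τ₃ : Bool}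

theorem spin_eq_iff : spin a = spin b + spin c ↔ a = b + c := by
  simp only [spin, ← add_div, div_left_inj' (two_ne_zero (α := ℚ))]
  norm_cast

theorem spin_lt_iff : spin a + spin b < spin c ↔ a + b < c := by
  simp only [spin, ← add_div, div_lt_div_iff_of_pos_right (zero_lt_two (α := ℚ))]
  norm_cast

theorem spin_le_iff : spin a + spin b ≤ spin c ↔ a + b ≤ c := by
  simp only [spin, ← add_div, div_le_div_iff_of_pos_right (zero_lt_two (α := ℚ))]
  norm_cast

theorem spin_add_one_le_iff : spin a + 1 ≤ spin b + spin c ↔ a + 2 ≤ b + c := by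
  simp only [spin, ← add_div, div_add_one (two_ne_zero (α := ℚ)),
    div_le_div_iff_of_pos_right (zero_lt_two (α := ℚ))]
  norm_cast

theorem triangle_iff : Triangle (spin N₁) (spin N₂) (spin N₃) ↔
    N₃ + 2 ≤ N₁ + N₂ ∧ N₂ + 2 ≤ N₁ + N₃ ∧ N₁ + 2 ≤ N₂ + N₃ := by
  simp only [Triangle, spin_add_one_le_iff]

theorem min_spin (a b : ℕ) : min (spin a) (spin b) = spin (min a b) := by
  rw [spin, spin, spin, min_div_div_right zero_le_two, Nat.cast_min]

theorem max_spin (a b : ℕ) : max (spin a) (spin b) = spin (max a b) := by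
  rw [spin, spin, spin, max_div_div_right zero_le_two, Nat.cast_max]

theorem le_sumS_sub_iff : (k : ℚ) ≤ sumS N₁ N₂ N₃ - a ↔ k + a ≤ N₁ / 2 + N₂ / 2 + N₃ / 2 := by
  rw [sumS, le_sub_iff_add_le]
  norm_cast

theorem eq_sumS_sub_iff : (k : ℚ) = sumS N₁ N₂ N₃ - a ↔ k + a = N₁ / 2 + N₂ / 2 + N₃ / 2 := by
  rw [sumS, eq_sub_iff_add_eq]
  norm_cast

theorem le_sumS_iff : (k : ℚ) ≤ sumS N₁ N₂ N₃ ↔ k ≤ N₁ / 2 + N₂ / 2 + N₃ / 2 :=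
  Nat.cast_le

theorem eq_sumS_iff : (k : ℚ) = sumS N₁ N₂ N₃ ↔ k = N₁ / 2 + N₂ / 2 + N₃ / 2 :=
  Nat.cast_inj

theorem mem_tableWW_iff : k ∈ tableWW N₁ N₂ N₃ τ₂ τ₃ ↔
    (N₃ + 2 ≤ N₁ + N₂ ∧ N₂ + 2 ≤ N₁ + N₃ ∧ N₁ + 2 ≤ N₂ + N₃) ∧
      if τ₂ = τ₃ then k + N₁ ≤ N₁ / 2 + N₂ / 2 + N₃ / 2
      else k + max N₂ N₃ ≤ N₁ / 2 + N₂ / 2 + N₃ / 2 := by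
  simp only [tableWW, Set.mem_ofPred_eq, triangle_iff, max_spin, two_mul_spin]
  split_ifs <;> rw [le_sumS_sub_iff]

theorem mem_tableWC_iff : k ∈ tableWC N₁ N₂ N₃ τ₂ τ₃ ↔
    ((N₃ + 2 ≤ N₁ + N₂ ∧ N₂ + 2 ≤ N₁ + N₃ ∧ N₁ + 2 ≤ N₂ + N₃) ∧
      k + min N₁ (min N₂ N₃) ≤ N₁ / 2 + N₂ / 2 + N₃ / 2) ∨
    (N₂ = N₁ + N₃ ∧ k + min N₁ N₃ ≤ N₁ / 2 + N₂ / 2 + N₃ / 2) ∨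
    (N₃ = N₁ + N₂ ∧ k + min N₁ N₂ ≤ N₁ / 2 + N₂ / 2 + N₃ / 2) ∨
    (N₁ + N₃ < N₂ ∧ if τ₂ = τ₃ then k ≤ N₁ / 2 + N₂ / 2 + N₃ / 2
      else k + min N₁ N₃ ≤ N₁ / 2 + N₂ / 2 + N₃ / 2) ∨
    (N₁ + N₂ < N₃ ∧ if τ₂ = τ₃ then k ≤ N₁ / 2 + N₂ / 2 + N₃ / 2
      else k + min N₁ N₂ ≤ N₁ / 2 + N₂ / 2 + N₃ / 2) := by
  simp only [tableWC, Set.mem_ofPred_eq, triangle_iff, min_spin, two_mul_spin, spin_eq_iff,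
    spin_lt_iff]
  split_ifs <;> simp only [le_sumS_sub_iff, le_sumS_iff]

theorem mem_tableCC_iff : k ∈ tableCC N₁ N₂ N₃ τ₂ τ₃ ↔
    (τ₂ = τ₃ ∧ ((N₃ + 2 ≤ N₁ + N₂ ∧ N₂ + 2 ≤ N₁ + N₃ ∧ N₁ + 2 ≤ N₂ + N₃) ∨ N₂ = N₁ + N₃ ∨
        N₃ = N₁ + N₂ ∨ N₂ + N₃ ≤ N₁) ∧ k = N₁ / 2 + N₂ / 2 + N₃ / 2) ∨
    (τ₂ ≠ τ₃ ∧ N₂ + N₃ ≤ N₁ ∧ k + min N₂ N₃ = N₁ / 2 + N₂ / 2 + N₃ / 2) := by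
  simp only [tableCC, Set.mem_ofPred_eq, triangle_iff, min_spin, two_mul_spin, spin_eq_iff,
    spin_le_iff, eq_sumS_iff, eq_sumS_sub_iff]

theorem tableWC_symm (N₁ N₂ N₃ : ℕ) (τ₂ τ₃ : Bool) :
    tableWC N₁ N₂ N₃ τ₂ τ₃ = tableWC N₁ N₃ N₂ τ₃ τ₂ := by
  ext k
  simp only [mem_tableWC_iff, eq_comm (a := τ₂), min_comm N₂ N₃, add_comm N₂ N₃,
    add_right_comm (N₁ / 2)]
  tauto

end Tables

/-! ### Counting of derivatives in the one-form sector -/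

section Counting

variable {N N₁ N₂ N₃ k : ℕ} {m a b : Bool → ℕ} {τ τ₂ τ₃ : Bool}

theorem GaugeDeg.add_not (h : GaugeDeg N a) (χ : Bool) : a χ + a (!χ) + 2 = N := by
  cases χ <;> simp only [GaugeDeg, Bool.not_true, Bool.not_false] at * <;> omega

theorem CurrentDeg.gaugeDeg (h : CurrentDeg N m) : GaugeDeg N m := h.1

theorem CurrentDeg.le_not (h : CurrentDeg N m) (χ : Bool) : m χ ≤ m (!χ) + 2 := by
  cases χ
  exacts [h.2.2, h.2.1]

theorem WeylDeg.cases_not (h : WeylDeg N b) (χ : Bool) : b χ = N + b (!χ) ∨ b (!χ) = N + b χ := by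
  cases χ
  exacts [h.symm, h]

theorem diagOrder_eq (m : Bool → ℕ) (χ : Bool) : diagOrder m = if m χ = m (!χ) then 1 else 0 := by
  cases χ
  exacts [if_congr eq_comm rfl rfl, rfl]

theorem weylOrder_eq (N : ℕ) (b : Bool → ℕ) (χ : Bool) :
    weylOrder N b = N / 2 + min (b χ) (b (!χ)) := by
  cases χ
  exacts [congrArg _ (min_comm _ _), rfl]

theorem two_mul_gaugeOrder (ha : GaugeDeg N a) (hτ : a (!τ) ≤ a τ) :
    2 * gaugeOrder a + N % 2 + a (!τ) = a τ := by
  simp only [GaugeDeg, gaugeOrder] at *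
  cases τ <;> simp only [Bool.not_true, Bool.not_false] at * <;> omega

theorem two_mul_diagOrder_le (hm : CurrentDeg N m) (χ : Bool) :
    2 * diagOrder m + N % 2 + m χ ≤ m (!χ) + 2 := by
  have := hm.le_not χ
  have := hm.gaugeDeg.add_not χ
  rw [diagOrder_eq m χ]
  split_ifs <;> omega

theorem gaugeOrder_add_gaugeOrder_mem_tableWW (hm : CurrentDeg N₁ m)
    (h : StarRel 0 1 2 ![m, a, b]) (ha : GaugeDeg N₂ a) (hb : GaugeDeg N₃ b)
    (hτ₂ : a (!τ₂) ≤ a τ₂) (hτ₃ : b (!τ₃) ≤ b τ₃) :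
    gaugeOrder a + gaugeOrder b + diagOrder m ∈ tableWW N₁ N₂ N₃ τ₂ τ₃ := by
  rw [mem_tableWW_iff]
  have ga := two_mul_gaugeOrder ha hτ₂
  have gb := two_mul_gaugeOrder hb hτ₃
  have dm := two_mul_diagOrder_le hm τ₂
  have dm' := two_mul_diagOrder_le hm (!τ₂)
  have sm := hm.gaugeDeg.add_not τ₂
  have sa := ha.add_not τ₂
  have sb := hb.add_not τ₂
  obtain ⟨h1, h2, h3, -⟩ := h τ₂
  obtain ⟨h1', h2', h3', -⟩ := h (!τ₂)
  simp only [Matrix.cons_val, Pi.zero_apply, add_zero, Bool.not_not] at *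
  refine ⟨⟨by omega, by omega, by omega⟩, ?_⟩
  rcases Bool.eq_or_eq_not τ₃ τ₂ with rfl | rfl
  · rw [if_pos rfl]
    omega
  · rw [if_neg (by simp)]
    simp only [Bool.not_not] at *
    omega

theorem mem_tableWC_of_le (hpar : (N₁ + N₂ + N₃) % 2 = 0) (hN : N₁ + 2 ≤ N₂ + N₃)
    (hk : k + N₁ ≤ N₁ / 2 + N₂ / 2 + N₃ / 2 ∨ k + N₃ ≤ N₁ / 2 + N₂ / 2 + N₃ / 2) :
    k ∈ tableWC N₁ N₂ N₃ τ₂ τ₃ := by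
  rw [mem_tableWC_iff]
  generalize N₁ / 2 + N₂ / 2 + N₃ / 2 = s at *
  split_ifs <;> omega

theorem gaugeOrder_add_weylOrder_mem_tableWC {χ : Bool} (hm : CurrentDeg N₁ m)
    (h : WCRel χ 1 2 ![m, a, b]) (ha : GaugeDeg N₂ a) (hb : WeylDeg N₃ b)
    (hτ₂ : a (!τ₂) ≤ a τ₂) (hτ₃ : b (!τ₃) ≤ b τ₃) :
    gaugeOrder a + weylOrder N₃ b + diagOrder m ∈ tableWC N₁ N₂ N₃ τ₂ τ₃ := by
  have ga := two_mul_gaugeOrder ha hτ₂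
  have dm := two_mul_diagOrder_le hm χ
  have dm' := two_mul_diagOrder_le hm (!χ)
  have sm := hm.gaugeDeg.add_not χ
  have sa := ha.add_not χ
  obtain ⟨e, h1, h2, h3, h4⟩ := h
  rw [weylOrder_eq N₃ b χ]
  simp only [Matrix.cons_val, Bool.not_not] at *
  rcases hb.cases_not χ with hc | hc
  · rw [mem_tableWC_iff]
    right; right; right; left
    refine ⟨by omega, ?_⟩
    rcases Bool.eq_or_eq_not τ₂ χ with rfl | rfl
    · split_ifs with hττ
      · omega
      · obtain rfl : τ₃ = !τ₂ := Bool.eq_not.2 (Ne.symm hττ)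
        rw [Bool.not_not] at hτ₃
        omega
    · rw [Bool.not_not] at *
      split_ifs <;> omega
  · refine mem_tableWC_of_le (by omega) (by omega) ?_
    rcases Bool.eq_or_eq_not τ₂ χ with rfl | rfl
    · right
      omega
    · left
      rw [Bool.not_not] at *
      omega

theorem weylOrder_add_weylOrder_mem_tableCC {χ : Bool} (hm : CurrentDeg N₁ m) (hχ : m (!χ) ≤ m χ)
    (h : CCRel χ ![m, a, b]) (ha : WeylDeg N₂ a) (hb : WeylDeg N₃ b)
    (hτ₂ : a (!τ₂) ≤ a τ₂) (hτ₃ : b (!τ₃) ≤ b τ₃) :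
    weylOrder N₂ a + weylOrder N₃ b + diagOrder m ∈ tableCC N₁ N₂ N₃ τ₂ τ₃ := by
  have dm : m χ + diagOrder m = N₁ / 2 := by
    have := hm.gaugeDeg.add_not χ
    have := hm.le_not χ
    rw [diagOrder_eq m χ]
    split_ifs <;> omega
  have sm := hm.gaugeDeg.add_not χ
  have lm := hm.le_not χ
  have ha' := ha.cases_not χ
  have hb' := hb.cases_not χ
  obtain ⟨e, h1, h2, h3, h4⟩ := h
  rw [mem_tableCC_iff, weylOrder_eq N₂ a χ, weylOrder_eq N₃ b χ]
  simp only [Matrix.cons_val] at *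
  rcases Bool.eq_or_eq_not τ₂ χ with rfl | rfl
  · rcases Bool.eq_or_eq_not τ₃ τ₂ with rfl | rfl
    · exact .inl ⟨rfl, by omega, by omega⟩
    · rw [Bool.not_not] at hτ₃
      exact .inr ⟨by simp, by omega, by omega⟩
  · rw [Bool.not_not] at hτ₂
    rcases Bool.eq_or_eq_not τ₃ χ with rfl | rfl
    · exact .inr ⟨by simp, by omega, by omega⟩
    · rw [Bool.not_not] at hτ₃
      exact .inl ⟨rfl, by omega, by omega⟩

end Counting

/-! ### Vertices with gauge fields in the one-form sector -/

section Vertices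

variable (η : ℂ) {N₂ N₃ : ℕ} {P₂ P₃ : (Bool → ℕ) → Prop} {m : Bool → ℕ} {T : Set ℕ}

theorem vertexWW_part_mem_powersIn {w₂ w₃ : ℂ → OneForm A}
    (h₂ : ∀ ι, Graded (fun lam => w₂ lam ι) gaugeOrder P₂)
    (h₃ : ∀ ι, Graded (fun lam => w₃ lam ι) gaugeOrder P₃)
    (hP₂ : ∀ a, P₂ a → GaugeDeg N₂ a) (hP₃ : ∀ b, P₃ b → GaugeDeg N₃ b)
    (hT : ∀ a b, StarRel 0 1 2 ![m, a, b] → P₂ a → P₃ b → gaugeOrder a + gaugeOrder b ∈ T) :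
    (fun lam => (vertexWW (w₂ lam) (w₃ lam)).part m) ∈ powersIn T := by
  refine wedge_part_mem_powersIn fun ι ι' => ?_
  have comp_neg (f : Gen A) : comp m (-f) = -comp m f := (compₗ m).map_neg f
  simp only [comp_neg]
  refine neg_mem (comp_apply_mem_powersIn (B := N₂ + N₃) (h₂ ι) (h₃ ι') m
    (fun _ _ _ => starKernel_support (.inl ⟨rfl, rfl⟩)) (fun a b _ ha hb => ?_) hT)
  have := hP₂ a ha
  have := hP₃ b hb
  grind [GaugeDeg]

theorem WCRel.le_of_deg {χ : Bool} {w c : Fin 3} {v : LegDeg} (h : WCRel χ w c v)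
    (hw : GaugeDeg N₂ (v w)) (hc : WeylDeg N₃ (v c)) :
    v w true + v w false ≤ 3 * N₂ + N₃ ∧ v c true + v c false ≤ 3 * N₂ + N₃ := by
  have := hw.add_not χ
  have := hc.cases_not χ
  have := h.1
  cases χ <;> simp only [Bool.not_true, Bool.not_false] at * <;> omega

theorem comp_sum_mulK_mem_powersIn {F : Bool → ℂ → Gen A} (s : Bool → ℂ)
    (h : ∀ χ, (fun lam => comp m (F χ lam)) ∈ powersIn T) :
    (fun lam => comp m (∑ χ, s χ • mulK χ (F χ lam))) ∈ powersIn T := by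
  have comp_sum (lam : ℂ) :
      comp m (∑ χ, s χ • mulK χ (F χ lam)) = ∑ χ, s χ • mulKₗ χ (comp m (F χ lam)) := by
    change compₗ m _ = _
    simp only [map_sum, map_smul]
    exact Finset.sum_congr rfl fun χ _ => congrArg _ (comp_mulK m χ _)
  simp only [comp_sum]
  exact sum_mem_powersIn fun χ _ => Submodule.smul_mem _ _ (map_mem_powersIn _ (h χ))

theorem vertexWC_part_mem_powersIn {w : ℂ → OneForm A} {C : ℂ → Gen A}
    (h₂ : ∀ ι, Graded (fun lam => w lam ι) gaugeOrder P₂) (h₃ : Graded C (weylOrder N₃) P₃)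
    (hP₂ : ∀ a, P₂ a → GaugeDeg N₂ a) (hP₃ : ∀ b, P₃ b → WeylDeg N₃ b)
    (hT : ∀ χ a b, WCRel χ 1 2 ![m, a, b] → P₂ a → P₃ b → gaugeOrder a + weylOrder N₃ b ∈ T) :
    (fun lam => (vertexWC η (w lam) (C lam)).part m) ∈ powersIn T :=
  wedge_part_mem_powersIn fun _ ι' => comp_sum_mulK_mem_powersIn _ fun χ =>
    comp_apply_mem_powersIn (h₂ ι') h₃ m (fun _ _ _ => kernelWC_support (.inl ⟨rfl, rfl⟩))
      (fun a b h ha hb => h.le_of_deg (hP₂ a ha) (hP₃ b hb)) (hT χ)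

theorem vertexCW_part_mem_powersIn {w : ℂ → OneForm A} {C : ℂ → Gen A}
    (h₂ : Graded C (weylOrder N₂) P₂) (h₃ : ∀ ι, Graded (fun lam => w lam ι) gaugeOrder P₃)
    (hP₂ : ∀ b, P₂ b → WeylDeg N₂ b) (hP₃ : ∀ a, P₃ a → GaugeDeg N₃ a)
    (hT : ∀ χ a b, WCRel χ 1 2 ![m, a, b] → P₃ a → P₂ b → gaugeOrder a + weylOrder N₂ b ∈ T) :
    (fun lam => (vertexCW η (C lam) (w lam)).part m) ∈ powersIn T :=
  wedge_part_mem_powersIn fun _ ι' => comp_sum_mulK_mem_powersIn _ fun χ =>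
    comp_apply_mem_powersIn h₂ (h₃ ι').reflect m
      (fun _ _ _ => kernelWC_support (.inr ⟨rfl, rfl⟩))
      (fun b a h hb ha => (h.le_of_deg (hP₃ a ha) (hP₂ b hb)).symm)
      fun b a h hb ha => add_comm (gaugeOrder a) _ ▸ hT χ a b h ha hb

end Vertices

/-! ### Derivatives of exponential kernels -/

/-- The kernel of the derivative `∂/∂Y^v` of a vertex. -/
def Kernel.derivY (v : Var) (F : Kernel) : Kernel := fun μ ν ρ =>
  ((μ v : ℂ) + 1) * F (μ + Finsupp.single v 1) ν ρ

theorem pdY_apply (v : Var) (F : Kernel) (f g : Gen A) :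
    pdY v (F.apply f g) = (F.derivY v).apply f g := by
  funext μ
  simp only [pdY, Kernel.apply, Kernel.derivY, smul_finsum, smul_smul, mul_assoc]

theorem joinExpo_add_single_left (μ ν ρ : Expo) (v : Var) :
    joinExpo (μ + Finsupp.single v 1) ν ρ = joinExpo μ ν ρ + Finsupp.single (0, v) 1 := by
  classical
  ext ⟨i, x⟩
  fin_cases i <;> simp [joinExpo, Finsupp.single_apply, Prod.ext_iff]

theorem coeff_mul_pow_succ_div_factorial {G : Sym} (q : Sym) {x : Fin 3 × Var}
    (hG : MvPolynomial.pderiv x G = 0) (d : Fin 3 × Var →₀ ℕ) (j : ℕ) :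
    ((d x : ℂ) + 1) * (MvPolynomial.coeff (d + Finsupp.single x 1) (G * q ^ (j + 1)) /
        ((j + 1).factorial : ℂ)) =
      MvPolynomial.coeff d (G * MvPolynomial.pderiv x q * q ^ j) / (j.factorial : ℂ) := by
  have leibniz : MvPolynomial.pderiv x (G * q ^ (j + 1)) =
      MvPolynomial.C ((j : ℂ) + 1) * (G * MvPolynomial.pderiv x q * q ^ j) := by
    rw [MvPolynomial.pderiv_mul, hG, MvPolynomial.pderiv_pow, Nat.add_sub_cancel, map_add, map_one,
      map_natCast]
    push_cast
    ring
  have coeff_eq := congrArg (MvPolynomial.coeff d) leibniz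
  rw [MvPolynomial.coeff_pderiv, MvPolynomial.coeff_C_mul] at coeff_eq
  have : (j : ℂ) + 1 ≠ 0 := Nat.cast_add_one_ne_zero j
  have : (j.factorial : ℂ) ≠ 0 := Nat.cast_ne_zero.2 j.factorial_ne_zero
  rw [Nat.factorial_succ]
  push_cast
  field_simp
  linear_combination coeff_eq

theorem expKernel_derivY {G : Sym} (q : Sym) {v : Var} (hG : MvPolynomial.pderiv (0, v) G = 0) :
    (expKernel G q).derivY v = expKernel (G * MvPolynomial.pderiv (0, v) q) q := by
  funext μ ν ρ
  have hμ : μ v = joinExpo μ ν ρ (0, v) := rfl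
  simp only [Kernel.derivY, expKernel, joinExpo_add_single_left, map_add, Finsupp.degree_single, hμ]
  rw [Finset.mul_sum, Finset.sum_range_succ']
  have constant_term : ((joinExpo μ ν ρ (0, v) : ℂ) + 1) *
      MvPolynomial.coeff (joinExpo μ ν ρ + Finsupp.single (0, v) 1) (G * q ^ 0) = 0 := by
    have h := MvPolynomial.coeff_pderiv (i := (0, v)) G (joinExpo μ ν ρ)
    rw [hG, MvPolynomial.coeff_zero] at h
    rw [pow_zero, mul_one, mul_comm, ← h]
  rw [← mul_div_assoc, constant_term, zero_div, add_zero]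
  exact Finset.sum_congr rfl fun j _ => coeff_mul_pow_succ_div_factorial q hG _ j

theorem pderiv_leg {i : Fin 3} (hi : i ≠ 0) (χ : Bool) (a : Fin 2) (v : Var) :
    MvPolynomial.pderiv (0, v) (leg i χ a) = 0 :=
  MvPolynomial.pderiv_X_of_ne fun h => hi (congrArg Prod.fst h)

theorem pderiv_pp {i j : Fin 3} (hi : i ≠ 0) (hj : j ≠ 0) (χ : Bool) (v : Var) :
    MvPolynomial.pderiv (0, v) (pp χ i j) = 0 := by
  simp [pp, pderiv_leg hi, pderiv_leg hj]

theorem pderiv_py {i : Fin 3} (hi : i ≠ 0) (χ c : Bool) (b : Fin 2) :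
    MvPolynomial.pderiv (0, (c, b)) (py χ i) = if c = χ then leg i χ b else 0 := by
  classical
  simp only [py, map_sum, MvPolynomial.pderiv_mul, pderiv_leg hi, zero_mul, zero_add]
  simp only [leg, MvPolynomial.pderiv_X, Pi.single_apply, Prod.mk.injEq, true_and]
  by_cases h : c = χ
  · subst h
    simp
  · simp [h, Ne.symm h]

theorem deg_add_single (χ : Bool) (μ : Expo) (v : Var) :
    deg χ (μ + Finsupp.single v 1) = deg χ μ + if χ = v.1 then 1 else 0 := by
  obtain ⟨c, b⟩ := v
  simp only [deg, Finsupp.add_apply, Finset.sum_add_distrib]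
  congr 1
  by_cases h : χ = c
  · subst h
    fin_cases b <;> simp [Finsupp.single_apply]
  · refine (Finset.sum_eq_zero fun x _ => ?_).trans (if_neg h).symm
    exact Finsupp.single_eq_of_ne fun h' => h (congrArg Prod.fst h')

theorem pdY_comp_congr {χ : Bool} {f₀ f₁ : Gen A} (h : pdY (χ, 1) f₀ = pdY (χ, 0) f₁)
    (m : Bool → ℕ) : pdY (χ, 1) (comp m f₀) = pdY (χ, 0) (comp m f₁) := by
  funext μ
  simp only [pdY, comp, deg_add_single, smul_ite, smul_zero]
  exact if_congr Iff.rfl (congrFun h μ) rfl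

theorem sum_act_p (χ : Bool) (f : Fin 2 → Gen A) :
    ∑ b, Slot.p.act χ b (f b) = (-Complex.I) • (pdY (χ, 1) (f 0) - pdY (χ, 0) (f 1)) := by
  simp only [Slot.act, eps, Fin.sum_univ_two, Matrix.of_apply, Matrix.cons_val, zero_mul, one_mul,
    neg_one_mul, neg_neg, zero_smul, zero_add, add_zero]
  module

/-! ### Currents of two zero-forms -/

-- The derivative of the exponent is proportional to the prefactor `t₂ p̄₁ - t₁ p̄₂`.
theorem kernelCCAux_derivY (χ : Bool) (a : Fin 2) (t₁ t₂ t₃ t₄ : ℝ) :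
    (kernelCCAux χ a 0 t₁ t₂ t₃ t₄).derivY (!χ, 1) =
      (kernelCCAux χ a 1 t₁ t₂ t₃ t₄).derivY (!χ, 0) := by
  have h1 : (1 : Fin 3) ≠ 0 := by decide
  have h2 : (2 : Fin 3) ≠ 0 := by decide
  simp only [kernelCCAux]
  rw [expKernel_derivY, expKernel_derivY]
  · refine congrArg (expKernel · _) ?_
    simp only [map_add, map_sub, MvPolynomial.pderiv_C_mul, pderiv_py h1, pderiv_py h2,
      pderiv_pp h1 h2, Bool.not_eq_self, if_true, if_false]
    simp only [map_mul]
    ring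
  all_goals simp [pderiv_leg h1, pderiv_leg h2]

theorem kernelCC_derivY (χ : Bool) (a : Fin 2) :
    (kernelCC χ a 0).derivY (!χ, 1) = (kernelCC χ a 1).derivY (!χ, 0) := by
  funext μ ν ρ
  have aux_eq (t₁ t₂ t₃ t₄ : ℝ) := congrFun₃ (kernelCCAux_derivY χ a t₁ t₂ t₃ t₄) μ ν ρ
  simp only [Kernel.derivY] at aux_eq
  simp only [Kernel.derivY, kernelCC, ← intervalIntegral.integral_const_mul]
  refine intervalIntegral.integral_congr fun t₄ _ => ?_
  rw [← deriv_const_mul_field, ← deriv_const_mul_field]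
  simp only [← intervalIntegral.integral_const_mul, aux_eq]

section VertexCC

variable (η : ℂ)

theorem vertexCC_part_at_p (C₂ C₃ : Gen A) (m : Bool → ℕ) (c : Bool) (u : Slot) :
    ((vertexCC η C₂ C₃).part m).at c u .p = 0 := by
  have pdY_mulK (v : Var) (χ : Bool) (f : Gen A) : pdY v (mulK χ f) = mulK χ (pdY v f) := rfl
  have contraction (a : Fin 2) : pdY (c, 1) ((vertexCC η C₂ C₃).part m c a 0) =
      pdY (c, 0) ((vertexCC η C₂ C₃).part m c a 1) := by
    refine pdY_comp_congr ?_ m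
    have := kernelCC_derivY (!c) a
    rw [Bool.not_not] at this
    simp only [vertexCC, pdY_smul, pdY_mulK, pdY_apply, this]
  refine Finset.sum_eq_zero fun a _ => ?_
  simp only [← Slot.actₗ_apply u, ← map_sum]
  rw [sum_act_p, contraction, sub_self, smul_zero, map_zero]

theorem vertexCC_part_apply_mem_powersIn {N₂ N₃ : ℕ} {C₂ C₃ : ℂ → Gen A}
    {P₂ P₃ : (Bool → ℕ) → Prop} {m : Bool → ℕ} {T : Set ℕ} {c : Bool}
    (h₂ : Graded C₂ (weylOrder N₂) P₂) (h₃ : Graded C₃ (weylOrder N₃) P₃)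
    (hP₂ : ∀ a, P₂ a → WeylDeg N₂ a) (hP₃ : ∀ b, P₃ b → WeylDeg N₃ b)
    (hT : ∀ a b, CCRel (!c) ![m, a, b] → P₂ a → P₃ b → weylOrder N₂ a + weylOrder N₃ b ∈ T)
    (a b : Fin 2) :
    (fun lam => (vertexCC η (C₂ lam) (C₃ lam)).part m c a b) ∈ powersIn T := by
  have part_eq (lam : ℂ) : (vertexCC η (C₂ lam) (C₃ lam)).part m c a b =
      (-(Complex.I * coupling η true * coupling η false) / 8) • mulKₗ true (mulKₗ false
        (comp m ((kernelCC (!c) a b).apply (C₂ lam) (C₃ lam)))) := by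
    change compₗ m _ = _
    rw [vertexCC, map_smul]
    exact congrArg _ ((comp_mulK m _ _).trans (congrArg _ (comp_mulK m _ _)))
  simp only [part_eq]
  refine Submodule.smul_mem _ _ (map_mem_powersIn _ (map_mem_powersIn _ (comp_apply_mem_powersIn
    (B := N₂ + N₃ + 2 * (m true + m false)) h₂ h₃ m (fun _ _ _ => kernelCC_support)
    (fun a b hR ha hb => ?_) hT)))
  have := hP₂ a ha
  have := hP₃ b hb
  have := hR.1
  simp only [WeylDeg, Matrix.cons_val] at *
  cases c <;> simp only [Bool.not_true, Bool.not_false] at * <;> omega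

theorem carries_vertexCC (bg : Background) {N₁ N₂ N₃ : ℕ} {C₂ C₃ : ℂ → Gen A}
    {P₂ P₃ : (Bool → ℕ) → Prop} (h₂ : Graded C₂ (weylOrder N₂) P₂)
    (h₃ : Graded C₃ (weylOrder N₃) P₃) (hP₂ : ∀ a, P₂ a → WeylDeg N₂ a)
    (hP₃ : ∀ b, P₃ b → WeylDeg N₃ b) {T : Set ℕ}
    (hT : ∀ χ m a b, CurrentDeg N₁ m → m (!χ) ≤ m χ → CCRel χ ![m, a, b] → P₂ a → P₃ b →
      weylOrder N₂ a + weylOrder N₃ b + diagOrder m ∈ T) :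
    Carries (fun lam => currentOne bg lam N₁ (vertexCC η (C₂ lam) (C₃ lam))) T := by
  refine CurrentContractionsIn.carries_currentOne bg fun m c u v hm huv => ?_
  cases v with
  | p =>
    simp only [vertexCC_part_at_p]
    exact zero_mem _
  | y =>
    obtain ⟨-, hc⟩ := huv rfl
    simp only [TwoForm.at, ← Slot.actₗ_apply]
    refine sum_mem_powersIn fun a _ => sum_mem_powersIn fun b _ => map_mem_powersIn _
      (map_mem_powersIn _ (vertexCC_part_apply_mem_powersIn η h₂ h₃ hP₂ hP₃ ?_ a b))
    exact fun a b => hT (!c) m a b hm (by simpa only [Bool.not_not] using hc)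

end VertexCC

/-! ### Derivatives of the factors of a vertex -/

theorem expKernel_eq_sum {q : Sym} (hq : MvPolynomial.constantCoeff q = 0) (G : Sym)
    {μ ν ρ : Expo} {n : ℕ} (hn : (joinExpo μ ν ρ).degree < n) :
    expKernel G q μ ν ρ = ∑ j ∈ Finset.range n,
      MvPolynomial.coeff (joinExpo μ ν ρ) (G * q ^ j) / (j.factorial : ℂ) := by
  refine Finset.sum_subset (Finset.range_subset_range.2 hn) fun j _ hj => ?_
  have q_mem : q ∈ MvPolynomial.idealOfVars (Fin 3 × Var) ℂ ^ 1 := by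
    refine (MvPolynomial.mem_pow_idealOfVars_iff' 1 q).2 fun x hx => ?_
    rwa [(Finsupp.degree_eq_zero_iff x).1 (Nat.lt_one_iff.1 hx)]
  have hmem : G * q ^ j ∈ MvPolynomial.idealOfVars (Fin 3 × Var) ℂ ^ j :=
    Ideal.mul_mem_left _ _ (Ideal.pow_mem_pow (pow_one (MvPolynomial.idealOfVars _ ℂ) ▸ q_mem) j)
  rw [(MvPolynomial.mem_pow_idealOfVars_iff' j _).1 hmem _ (by simpa using hj), zero_div]

theorem expKernel_mul_leg_eq_zero {G q : Sym} {i : Fin 3} {χ : Bool} {b : Fin 2} {μ ν ρ : Expo}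
    (h : joinExpo μ ν ρ (i, (χ, b)) = 0) : expKernel (G * leg i χ b) q μ ν ρ = 0 := by
  classical
  refine Finset.sum_eq_zero fun j _ => ?_
  rw [mul_right_comm, leg, MvPolynomial.coeff_mul_X', if_neg (by simpa using h), zero_div]

theorem expKernel_mul_leg {q : Sym} (hq : MvPolynomial.constantCoeff q = 0) (G : Sym)
    {i : Fin 3} {χ : Bool} {b : Fin 2} {μ ν ρ μ' ν' ρ' : Expo}
    (h : joinExpo μ' ν' ρ' = joinExpo μ ν ρ + Finsupp.single (i, (χ, b)) 1) :
    expKernel (G * leg i χ b) q μ' ν' ρ' = expKernel G q μ ν ρ := by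
  rw [expKernel_eq_sum hq G (n := (joinExpo μ ν ρ).degree + 2) (by omega), expKernel, h, map_add,
    Finsupp.degree_single]
  refine Finset.sum_congr rfl fun j _ => ?_
  rw [mul_right_comm, leg, MvPolynomial.coeff_mul_X]

theorem joinExpo_add_single_middle (μ ν ρ : Expo) (v : Var) :
    joinExpo μ (ν + Finsupp.single v 1) ρ = joinExpo μ ν ρ + Finsupp.single (1, v) 1 := by
  classical
  ext ⟨i, x⟩
  fin_cases i <;> simp [joinExpo, Finsupp.single_apply, Prod.ext_iff]

theorem joinExpo_add_single_right (μ ν ρ : Expo) (v : Var) :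
    joinExpo μ ν (ρ + Finsupp.single v 1) = joinExpo μ ν ρ + Finsupp.single (2, v) 1 := by
  classical
  ext ⟨i, x⟩
  fin_cases i <;> simp [joinExpo, Finsupp.single_apply, Prod.ext_iff]

theorem pairing_add_single (ν : Expo) (v : Var) :
    pairing (ν + Finsupp.single v 1) = -Complex.I * pairing ν * ((ν v : ℂ) + 1) := by
  classical
  have factorials : ∏ w, (((ν + Finsupp.single v 1 : Expo) w).factorial : ℂ) =
      ((ν v : ℂ) + 1) * ∏ w, ((ν w).factorial : ℂ) := by
    rw [← Finset.mul_prod_erase _ _ (Finset.mem_univ v),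
      ← Finset.mul_prod_erase _ (fun w => ((ν w).factorial : ℂ)) (Finset.mem_univ v), ← mul_assoc]
    congr 1
    · simp [Nat.factorial_succ]
    · refine Finset.prod_congr rfl fun w hw => ?_
      rw [Finsupp.add_apply, Finsupp.single_eq_of_ne (Finset.ne_of_mem_erase hw), add_zero]
  rw [pairing, factorials, map_add, Finsupp.degree_single, pow_succ, pairing]
  ring

/-- The sign change of the odd part in the Klein operator of chirality `χ`, which results from
moving a variable of this chirality through the Klein operators to the left of it. -/
def kleinTwist (χ : Bool) (f : Gen A) : Gen A := fun μ κ => (if κ χ = 1 then -1 else 1 : ℂ) • f μ κ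

theorem twMul_add_single (ρ : Expo) (v : Var) (f : Gen A) (ν : Expo) (u : Klein → SmoothFun A) :
    twMul (ρ + Finsupp.single v 1) (f ν) u = twMul ρ (kleinTwist v.1 f ν) u := by
  funext κ
  refine Finset.sum_congr rfl fun κ₁ _ => ?_
  have sign_eq : (∏ χ, if κ₁ χ = 1 then (-1 : ℂ) ^ deg χ (ρ + Finsupp.single v 1) else 1) =
      (∏ χ, if κ₁ χ = 1 then (-1 : ℂ) ^ deg χ ρ else 1) * if κ₁ v.1 = 1 then -1 else 1 := by
    obtain ⟨χ, b⟩ := v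
    simp only [Fintype.prod_bool, deg_add_single]
    cases χ <;> split_ifs <;> simp_all [pow_succ]
  rw [kleinTwist, smul_mul_assoc, smul_smul, sign_eq]

theorem finsum_comp_of_injective {α β M : Type*} [AddCommMonoid M] {F : α → M} {e : β → α}
    (he : Function.Injective e) (h : Function.support F ⊆ Set.range e) :
    ∑ᶠ y, F (e y) = ∑ᶠ x, F x := by
  rw [← finsum_mem_range he, finsum_mem_def, Set.indicator_eq_self.2 h]

theorem exists_add_single_eq {ν : Expo} {v : Var} (h : ν v ≠ 0) :
    ∃ ν', ν' + Finsupp.single v 1 = ν :=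
  ⟨ν - Finsupp.single v 1, tsub_add_cancel_of_le (by simpa [Nat.one_le_iff_ne_zero] using h)⟩

theorem apply_mul_leg_one {q : Sym} (hq : MvPolynomial.constantCoeff q = 0) (G : Sym)
    (χ : Bool) (b : Fin 2) (f g : Gen A) :
    (expKernel (G * leg 1 χ b) q).apply f g =
      (expKernel G q).apply ((-Complex.I) • pdY (χ, b) f) g := by
  funext μ
  refine (finsum_comp_of_injective
    (e := fun p : Expo × Expo => (p.1 + Finsupp.single (χ, b) 1, p.2)) ?_ ?_).symm.trans
    (finsum_congr fun p => ?_)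
  · rintro ⟨x, y⟩ ⟨x', y'⟩ hp
    simpa using hp
  · rintro ⟨x, y⟩ hp
    obtain ⟨x', hx'⟩ := exists_add_single_eq (ν := x) (v := (χ, b)) fun h0 =>
      (ne_zero_of_apply_term_ne_zero hp).1 (expKernel_mul_leg_eq_zero h0)
    exact ⟨(x', y), Prod.ext hx' rfl⟩
  · have pull_out (c : ℂ) (u w : Klein → SmoothFun A) :
        twMul p.2 (c • u) w = c • twMul p.2 u w := by
      simpa using twMul_smul p.2 c 1 u w
    simp only [expKernel_mul_leg hq G (joinExpo_add_single_middle μ p.1 p.2 _), pairing_add_single,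
      Pi.smul_apply, pdY, pull_out, smul_smul]
    congr 1
    ring

theorem apply_mul_leg_two {q : Sym} (hq : MvPolynomial.constantCoeff q = 0) (G : Sym)
    (χ : Bool) (b : Fin 2) (f g : Gen A) :
    (expKernel (G * leg 2 χ b) q).apply f g =
      (expKernel G q).apply (kleinTwist χ f) ((-Complex.I) • pdY (χ, b) g) := by
  funext μ
  refine (finsum_comp_of_injective
    (e := fun p : Expo × Expo => (p.1, p.2 + Finsupp.single (χ, b) 1)) ?_ ?_).symm.trans
    (finsum_congr fun p => ?_)
  · rintro ⟨x, y⟩ ⟨x', y'⟩ hp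
    simpa using hp
  · rintro ⟨x, y⟩ hp
    obtain ⟨y', hy'⟩ := exists_add_single_eq (ν := y) (v := (χ, b)) fun h0 =>
      (ne_zero_of_apply_term_ne_zero hp).1 (expKernel_mul_leg_eq_zero h0)
    exact ⟨(x, y'), Prod.ext rfl hy'⟩
  · have pull_out (c : ℂ) (u w : Klein → SmoothFun A) :
        twMul p.2 u (c • w) = c • twMul p.2 u w := by
      simpa using twMul_smul p.2 1 c u w
    simp only [expKernel_mul_leg hq G (joinExpo_add_single_right μ p.1 p.2 _), pairing_add_single,
      twMul_add_single, Pi.smul_apply, pdY, pull_out, smul_smul]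
    congr 1
    ring

/-! ### Star products with one differentiated factor -/

theorem constantCoeff_starExponent : MvPolynomial.constantCoeff starExponent = 0 := by
  simp [starExponent, pp, py, leg]

theorem pderiv_starExponent (χ : Bool) (b : Fin 2) :
    MvPolynomial.pderiv (0, (χ, b)) starExponent =
      MvPolynomial.C Complex.I * (leg 1 χ b + leg 2 χ b) := by
  have h1 : (1 : Fin 3) ≠ 0 := by decide
  have h2 : (2 : Fin 3) ≠ 0 := by decide
  simp only [starExponent, map_sum, MvPolynomial.pderiv_C_mul, map_add, map_neg,
    pderiv_pp h1 h2, pderiv_py h1, pderiv_py h2, neg_zero, zero_add]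
  cases χ <;> simp

/-- The kernel of the star product with a polynomial prefactor `G`. -/
def starG (G : Sym) : Kernel := expKernel G starExponent

/-- The leg of the one-form in a product of a one-form and a zero-form; the one-form is the first
factor if `o = true` and the second one if `o = false`. -/
def legOf (o : Bool) : Fin 3 := if o then 1 else 2

/-- The value of a vertex whose factor `f` has leg `legOf o` and whose factor `g` has leg
`legOf (!o)`. -/
def ordApply (o : Bool) (F : Kernel) (f g : Gen A) : Gen A := if o then F.apply f g else F.apply g f

theorem legOf_ne_zero (o : Bool) : legOf o ≠ 0 := by cases o <;> decide

theorem legs_legOf (o : Bool) : Legs (legOf o) (legOf (!o)) := by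
  cases o
  exacts [.inr ⟨rfl, rfl⟩, .inl ⟨rfl, rfl⟩]

theorem ordApply_mul_leg (o : Bool) (G : Sym) {χ : Bool} {f₀ f₁ : Gen A}
    (h : pdY (χ, 1) f₀ = pdY (χ, 0) f₁) (g : Gen A) :
    ordApply o (starG (G * leg (legOf o) χ 1)) f₀ g =
      ordApply o (starG (G * leg (legOf o) χ 0)) f₁ g := by
  cases o
  · exact (apply_mul_leg_two constantCoeff_starExponent ..).trans
      (h ▸ (apply_mul_leg_two constantCoeff_starExponent ..).symm)
  · exact (apply_mul_leg_one constantCoeff_starExponent ..).trans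
      (h ▸ (apply_mul_leg_one constantCoeff_starExponent ..).symm)

theorem starG_add (G G' : Sym) : starG (G + G') = starG G + starG G' := by
  funext μ ν ρ
  simp only [starG, expKernel, Pi.add_apply, add_mul, MvPolynomial.coeff_add, add_div,
    Finset.sum_add_distrib]

theorem starG_C_mul (c : ℂ) (G : Sym) : starG (MvPolynomial.C c * G) = c • starG G := by
  funext μ ν ρ
  simp only [starG, expKernel, Pi.smul_apply, smul_eq_mul, mul_assoc, MvPolynomial.coeff_C_mul,
    mul_div_assoc, Finset.mul_sum]

theorem smul_apply (c : ℂ) (F : Kernel) (f g : Gen A) : (c • F).apply f g = c • F.apply f g := by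
  funext μ
  simp only [Kernel.apply, Pi.smul_apply, smul_eq_mul, smul_finsum, smul_smul, mul_assoc]

theorem finite_starG_ne_zero (G : Sym) (μ ν : Expo) :
    {ρ | starG G μ ν ρ ≠ 0}.Finite ∧ {ρ | starG G μ ρ ν ≠ 0}.Finite := by
  let Q (v : LegDeg) : Prop := ∀ χ, v 2 χ ≤ v 0 χ + v 1 χ + G.totalDegree ∧
    v 1 χ ≤ v 0 χ + v 2 χ + G.totalDegree
  have G_mem : G ∈ degMap (· = 0) Q := by
    rintro e he v rfl χ
    have le (i : Fin 3) : legDeg e i χ ≤ G.totalDegree := calc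
      legDeg e i χ ≤ ∑ c, legDeg e i c := Finset.single_le_sum_of_canonicallyOrdered (by simp)
      _ ≤ ∑ j, ∑ c, legDeg e j c :=
        Finset.single_le_sum_of_canonicallyOrdered (f := fun j => ∑ c, legDeg e j c) (by simp)
      _ = e.degree := by simp only [Finsupp.degree_eq_sum, Fintype.sum_prod_type, legDeg]
      _ ≤ G.totalDegree := MvPolynomial.le_totalDegree he
    simp only [zero_add]
    exact ⟨(le 2).trans le_add_self, (le 1).trans le_add_self⟩
  have exponent_mem : starExponent ∈ degMap Q Q := by
    refine sum_mem fun χ _ => C_mul_mem_degMap _ (add_mem (add_mem (neg_mem (pp_mem_degMap ?_))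
      (py_mem_degMap ?_)) (py_mem_degMap ?_)) <;>
    · intro v hv c
      have := hv c
      simp only [unitDeg, Pi.add_apply]
      grind
  have support {μ ν ρ : Expo} (h : starG G μ ν ρ ≠ 0) := expKernel_support G_mem exponent_mem h
  constructor <;>
  · refine (finite_degree_le (deg true μ + deg false μ + (deg true ν + deg false ν) +
      2 * G.totalDegree)).subset fun ρ hρ => ?_
    have := support hρ true
    have := support hρ false
    simp only [bideg, Matrix.cons_val, Set.mem_ofPred_eq] at *
    omega

theorem add_apply {F F' : Kernel} {f g : Gen A} {μ : Expo}
    (h : {p : Expo × Expo | F μ p.1 p.2 ≠ 0 ∧ f p.1 ≠ 0 ∧ g p.2 ≠ 0}.Finite)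
    (h' : {p : Expo × Expo | F' μ p.1 p.2 ≠ 0 ∧ f p.1 ≠ 0 ∧ g p.2 ≠ 0}.Finite) :
    (F + F').apply f g μ = F.apply f g μ + F'.apply f g μ := by
  simp only [Kernel.apply]
  rw [← finsum_add_distrib]
  · simp only [Pi.add_apply, add_mul, add_smul]
  · exact h.subset fun _ => ne_zero_of_apply_term_ne_zero
  · exact h'.subset fun _ => ne_zero_of_apply_term_ne_zero

theorem ordApply_starG_add (o : Bool) (G G' : Sym) {f : Gen A} (hf : {ν | f ν ≠ 0}.Finite)
    (g : Gen A) : ordApply o (starG (G + G')) f g =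
      ordApply o (starG G) f g + ordApply o (starG G') f g := by
  have finite_left (G : Sym) (μ : Expo) :
      {p : Expo × Expo | starG G μ p.1 p.2 ≠ 0 ∧ f p.1 ≠ 0 ∧ g p.2 ≠ 0}.Finite :=
    (hf.biUnion fun ν _ => ((finite_starG_ne_zero G μ ν).1.image (Prod.mk ν))).subset
      fun p hp => Set.mem_biUnion hp.2.1 ⟨p.2, hp.1, rfl⟩
  have finite_right (G : Sym) (μ : Expo) :
      {p : Expo × Expo | starG G μ p.1 p.2 ≠ 0 ∧ g p.1 ≠ 0 ∧ f p.2 ≠ 0}.Finite :=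
    (hf.biUnion fun ρ _ => ((finite_starG_ne_zero G μ ρ).2.image (·, ρ))).subset
      fun p hp => Set.mem_biUnion hp.2.2 ⟨p.1, hp.1, rfl⟩
  rw [starG_add]
  funext μ
  cases o
  · exact add_apply (finite_right G μ) (finite_right G' μ)
  · exact add_apply (finite_left G μ) (finite_left G' μ)

theorem pdY_ordApply (o : Bool) {G : Sym} {χ : Bool} {b : Fin 2}
    (hG : MvPolynomial.pderiv (0, (χ, b)) G = 0) {f : Gen A} (hf : {ν | f ν ≠ 0}.Finite)
    (g : Gen A) : pdY (χ, b) (ordApply o (starG G) f g) = Complex.I •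
      (ordApply o (starG (G * leg (legOf o) χ b)) f g +
        ordApply o (starG (G * leg (legOf (!o)) χ b)) f g) := by
  have derivY_eq : (starG G).derivY (χ, b) =
      Complex.I • starG (G * leg (legOf o) χ b + G * leg (legOf (!o)) χ b) := by
    rw [starG, expKernel_derivY _ hG, pderiv_starExponent, mul_left_comm, ← starG, starG_C_mul]
    cases o
    · rw [mul_add, add_comm]; rfl
    · rw [mul_add]; rfl
  rw [← ordApply_starG_add o _ _ hf]
  cases o
  all_goals exact (pdY_apply ..).trans (derivY_eq ▸ smul_apply ..)

theorem sum_act_p_ordApply (o : Bool) {G : Sym} {χ : Bool}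
    (hG : ∀ v, MvPolynomial.pderiv (0, v) G = 0) {f : Fin 2 → Gen A}
    (hf : ∀ b, {ν | f b ν ≠ 0}.Finite) (h : pdY (χ, 1) (f 0) = pdY (χ, 0) (f 1)) (g : Gen A) :
    ∑ b, Slot.p.act χ b (ordApply o (starG G) (f b) g) =
      ordApply o (starG (G * leg (legOf (!o)) χ 1)) (f 0) g -
        ordApply o (starG (G * leg (legOf (!o)) χ 0)) (f 1) g := by
  rw [sum_act_p, pdY_ordApply o (hG _) (hf 0), pdY_ordApply o (hG _) (hf 1),
    ordApply_mul_leg o G h]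
  refine (congrArg (-Complex.I • ·) (smul_sub Complex.I (_ : Gen A) _).symm).trans ?_
  rw [add_sub_add_left_eq_sub, smul_smul, neg_mul, Complex.I_mul_I, neg_neg, one_smul]

/-! ### Currents in the zero-form sector -/

/-- The contraction `w.at χ u v` as a linear map. -/
def OneForm.atₗ (χ : Bool) (u v : Slot) : OneForm A →ₗ[ℂ] Gen A :=
  ∑ a, ∑ b, u.actₗ χ a ∘ₗ v.actₗ (!χ) b ∘ₗ LinearMap.proj (pair χ a b)

theorem OneForm.atₗ_apply (w : OneForm A) (χ : Bool) (u v : Slot) : atₗ χ u v w = w.at χ u v := by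
  simp only [atₗ, LinearMap.sum_apply, LinearMap.comp_apply, Slot.actₗ_apply]
  rfl

theorem OneForm.part_at_mem_powersIn {w : ℂ → OneForm A} {m : Bool → ℕ} {T : Set ℕ} (χ : Bool)
    (u v : Slot) (h : ∀ ι, (fun lam => comp m (w lam ι)) ∈ powersIn T) :
    (fun lam => ((w lam).part m).at χ u v) ∈ powersIn T := by
  have h_at := map_mem_powersIn (OneForm.atₗ χ u v) (pi_mem_powersIn h)
  simp only [OneForm.atₗ_apply] at h_at
  exact h_at

theorem carries_currentZero (bg : Background) (η : ℂ) (N : ℕ) {w : ℂ → OneForm A} {T : Set ℕ}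
    (hpp : N = 0 → (fun lam => ((w lam).part (pair true 1 1)).at true .p .p) ∈ powersIn T)
    (hyy : N = 0 →
      (fun lam => ((w lam).part (pair true 0 0)).at true .y .y) ∈ powersIn {k | k + 1 ∈ T})
    (hyp : ∀ χ, N = 1 ∨ N = 2 →
      (fun lam => ((w lam).part (pair χ 0 N)).at χ .y .p) ∈ powersIn T) :
    Carries (fun lam => currentZero bg η lam N (w lam)) T := by
  refine carries_iff_mem_powersIn.2 (pi_mem_powersIn fun l => ?_)
  match N, l with
  | 0, .main false =>
    exact Submodule.smul_mem _ _
      (sub_mem (Submodule.smul_mem _ _ (hpp rfl)) (bg.D_mem_powersIn _ _ _ (hyy rfl)))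
  | 1, .main χ => exact hyp χ (.inl rfl)
  | 2, .main false => exact sum_mem_powersIn fun χ _ => Submodule.smul_mem _ _ (hyp χ (.inr rfl))
  | 0, .main true | 2, .main true => exact zero_mem _
  | 0, .trace _ | 1, .trace _ | 2, .trace _ => exact zero_mem _
  | 0, .gammaTrace _ | 1, .gammaTrace _ | 2, .gammaTrace _ => exact zero_mem _
  | n + 3, l => cases l <;> exact zero_mem _

section TablesZero

variable {N₁ N₂ N₃ N k a b c : ℕ}

theorem spin_add_one_le_abs_sub_iff :
    spin a + 1 ≤ |spin b - spin c| ↔ a + 2 + c ≤ b ∨ a + 2 + b ≤ c := by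
  rw [le_abs', or_comm, le_sub_iff_add_le, ← neg_sub (spin c), neg_le_neg_iff, le_sub_iff_add_le,
    add_right_comm, add_right_comm (spin a) 1]
  simp only [spin, ← add_div, div_add_one (two_ne_zero (α := ℚ)),
    div_le_div_iff_of_pos_right (zero_lt_two (α := ℚ)), add_right_comm a 2]
  norm_cast

theorem abs_spin_sub_spin_le_iff : |spin b - spin c| ≤ spin a ↔ b ≤ a + c ∧ c ≤ a + b := by
  rw [abs_sub_le_iff, sub_le_iff_le_add, sub_le_iff_le_add]
  simp only [spin, ← add_div, div_le_div_iff_of_pos_right (zero_lt_two (α := ℚ))]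
  norm_cast

theorem mem_table0WC_iff : k ∈ table0WC N₁ N₂ N₃ N ↔
    ((N₁ = 1 ∨ N₁ = 2) ∧ N₁ + 2 ≤ N₂ + N₃ ∧
      (k + min N₁ (min N₂ N₃) = N₁ / 2 + N₂ / 2 + N₃ / 2 ∨
        (N₁ = 2 ∧ N < 2 ∧ k + 2 = N₁ / 2 + N₂ / 2 + N₃ / 2))) ∨
    ((N₁ = 0 ∨ N₁ = 1 ∨ N₁ = 2) ∧ (N₁ + 2 + N₃ ≤ N₂ ∨ N₁ + 2 + N₂ ≤ N₃) ∧
      k = N₁ / 2 + N₂ / 2 + N₃ / 2) := by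
  have spin_lt_one_iff : spin N < 1 ↔ N < 2 := by
    rw [spin, div_lt_one (zero_lt_two (α := ℚ))]
    norm_cast
  have eq_sumS_sub_two_iff :
      (k : ℚ) = sumS N₁ N₂ N₃ - 2 ↔ k + 2 = N₁ / 2 + N₂ / 2 + N₃ / 2 :=
    eq_sumS_sub_iff (a := 2)
  simp only [table0WC, Set.mem_ofPred_eq, min_spin, two_mul_spin, spin_add_one_le_iff,
    spin_lt_one_iff, spin_add_one_le_abs_sub_iff, eq_sumS_sub_two_iff, eq_sumS_sub_iff,
    eq_sumS_iff]

theorem mem_table0CC_iff : k ∈ table0CC N₁ N₂ N₃ ↔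
    ((N₁ = 1 ∨ N₁ = 2) ∧ N₂ + N₃ ≤ N₁ ∧
      k + min N₁ (min N₂ N₃) = N₁ / 2 + N₂ / 2 + N₃ / 2) ∨
    ((N₁ = 1 ∨ N₁ = 2) ∧ (N₂ ≤ N₁ + N₃ ∧ N₃ ≤ N₁ + N₂) ∧ k = N₁ / 2 + N₂ / 2 + N₃ / 2) ∨
    (N₁ = 0 ∧ (N₂ ≤ 2 + N₃ ∧ N₃ ≤ 2 + N₂) ∧ 2 ≤ N₂ + N₃ ∧ k = N₂ / 2 + N₃ / 2) := by
  have spin_two : spin 2 = 1 := by norm_num [spin]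
  have abs_le_one_iff : |spin N₂ - spin N₃| ≤ 1 ↔ N₂ ≤ 2 + N₃ ∧ N₃ ≤ 2 + N₂ := by
    rw [← spin_two, abs_spin_sub_spin_le_iff]
  have one_le_iff : 1 ≤ spin N₂ + spin N₃ ↔ 2 ≤ N₂ + N₃ := by
    rw [spin, spin, ← add_div, one_le_div (zero_lt_two (α := ℚ))]
    norm_cast
  simp only [table0CC, Set.mem_ofPred_eq, min_spin, two_mul_spin, spin_le_iff,
    abs_spin_sub_spin_le_iff, abs_le_one_iff, one_le_iff, eq_sumS_sub_iff, eq_sumS_iff,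
    Nat.cast_inj]

theorem table0WC_symm (N₁ N₂ N₃ N : ℕ) : table0WC N₁ N₂ N₃ N = table0WC N₁ N₃ N₂ N := by
  ext k
  rw [mem_table0WC_iff, mem_table0WC_iff, min_comm N₂ N₃, add_comm N₂ N₃,
    add_right_comm (N₁ / 2), or_comm (a := N₁ + 2 + N₃ ≤ N₂)]

end TablesZero

theorem weylOrder_add_weylOrder_mem_table0CC {N₁ N₂ N₃ : ℕ} {m a b : Bool → ℕ} {χ : Bool}
    (h : ZeroCCRel χ ![m, a, b]) (ha : WeylDeg N₂ a) (hb : WeylDeg N₃ b)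
    (hm : (N₁ = 0 ∧ m χ = 1 ∧ m (!χ) = 1) ∨ ((N₁ = 1 ∨ N₁ = 2) ∧ m χ = N₁ ∧ m (!χ) = 0)) :
    weylOrder N₂ a + weylOrder N₃ b ∈ table0CC N₁ N₂ N₃ := by
  obtain ⟨deg_sum, h1, h2, h3, h4⟩ := h
  rw [mem_table0CC_iff, weylOrder_eq N₂ a χ, weylOrder_eq N₃ b χ]
  have ha' := ha.cases_not χ
  have hb' := hb.cases_not χ
  simp only [Matrix.cons_val] at *
  obtain ⟨hN, h_deg, h_deg'⟩ | ⟨hN, h_deg, h_deg'⟩ := hm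
  · exact .inr (.inr ⟨hN, by omega, by omega, by omega⟩)
  · rcases hN with rfl | rfl
    · exact .inr (.inl ⟨.inl rfl, by omega, by omega⟩)
    · by_cases hmin : a (!χ) = 0 ∨ b (!χ) = 0 <;> omega

theorem carries_vertex0CC (bg : Background) (η : ℂ) {N₁ N₂ N₃ : ℕ} {C₂ C₃ : ℂ → Gen A}
    (h₂ : Graded C₂ (weylOrder N₂) (WeylDeg N₂)) (h₃ : Graded C₃ (weylOrder N₃) (WeylDeg N₃)) :
    Carries (fun lam => currentZero bg η lam N₁ (vertex0CC η (C₂ lam) (C₃ lam)))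
      (table0CC N₁ N₂ N₃) := by
  have at_mem_powersIn (m : Bool → ℕ) (c : Bool) (u v : Slot) (T : Set ℕ)
      (hT : ∀ χ a b, ZeroCCRel χ ![m, a, b] → WeylDeg N₂ a → WeylDeg N₃ b →
        weylOrder N₂ a + weylOrder N₃ b ∈ T) :
      (fun lam => ((vertex0CC η (C₂ lam) (C₃ lam)).part m).at c u v) ∈ powersIn T := by
    refine OneForm.part_at_mem_powersIn c u v fun ι => comp_sum_mulK_mem_powersIn _ fun χ =>
      comp_apply_mem_powersIn (B := N₂ + N₃ + 2 * (m true + m false)) h₂ h₃ m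
        (fun _ _ _ => kernel0CC_support) (fun a b hR ha hb => ?_) (hT χ)
    have deg_sum := hR.1
    simp only [WeylDeg, Matrix.cons_val] at ha hb deg_sum
    cases χ <;> omega
  refine carries_currentZero bg η N₁
    (fun hN => at_mem_powersIn _ _ _ _ _ fun χ a b hR ha hb => ?_)
    (fun _ => at_mem_powersIn _ _ _ _ _ fun χ a b hR _ _ => ?_)
    (fun c hN => at_mem_powersIn _ _ _ _ _ fun χ a b hR ha hb => ?_)
  · exact weylOrder_add_weylOrder_mem_table0CC hR ha hb (.inl ⟨hN, by simp [pair], by simp [pair]⟩)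
  · exact absurd hR.1 (by simp [pair])
  · have deg_pos := hR.1
    refine weylOrder_add_weylOrder_mem_table0CC hR ha hb (.inr ⟨hN, ?_⟩)
    cases c <;> cases χ <;> simp [pair] at deg_pos ⊢

/-! ### Star product of a gauge one-form and a zero-form -/

theorem pdY_comm (v w : Var) (f : Gen A) : pdY v (pdY w f) = pdY w (pdY v f) := by
  obtain rfl | hvw := eq_or_ne v w
  · rfl
  · funext μ
    simp only [pdY, smul_smul, Finsupp.add_apply, Finsupp.single_eq_of_ne hvw,
      Finsupp.single_eq_of_ne hvw.symm, add_zero, add_right_comm μ, mul_comm]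

theorem pdY_comp (v : Var) (m : Bool → ℕ) (f : Gen A) :
    pdY v (comp (m + Pi.single v.1 1) f) = comp m (pdY v f) := by
  funext μ
  have deg_eq_iff : (∀ χ, deg χ (μ + Finsupp.single v 1) =
      (m + Pi.single v.1 1 : Bool → ℕ) χ) ↔ ∀ χ, deg χ μ = m χ := by
    refine forall_congr' fun χ => ?_
    rw [deg_add_single, Pi.add_apply, Pi.single_apply, add_left_inj]
  simp only [pdY, comp, deg_eq_iff, smul_ite, smul_zero]

theorem act_p_comp (χ : Bool) (b : Fin 2) (m : Bool → ℕ) (f : Gen A) :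
    Slot.p.act χ b (comp (m + Pi.single χ 1) f) = comp m (Slot.p.act χ b f) := by
  change _ = compₗ m _
  simp only [Slot.act, pdY_comp (χ, _), map_sum, map_smul]
  rfl

section Omega

variable {N : ℕ} (Φ : FronsdalField A N) (bg : Background) (co : Coefficients) (lam : ℂ)

theorem pdY_omega {χ : Bool} {ι ι' : Bool → Fin 2} (h : ι (!χ) = ι' (!χ)) (h₀ : ι χ = 0)
    (h₁ : ι' χ = 1) :
    pdY (χ, 1) (Φ.omega bg lam co ι) = pdY (χ, 0) (Φ.omega bg lam co ι') := by
  have derivatives_eq (Ψ : Gen A) : pdY (χ, 1) (pdY (true, ι true) (pdY (false, ι false) Ψ)) =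
      pdY (χ, 0) (pdY (true, ι' true) (pdY (false, ι' false) Ψ)) := by
    cases χ
    · rw [h₀, h₁, show ι true = ι' true from h, pdY_comm (false, 1), pdY_comm (false, 0) (true, _),
        pdY_comm (false, 1)]
    · rw [h₀, h₁, show ι false = ι' false from h, pdY_comm]
  funext μ
  have h_coeff := fun Ψ => congrFun (derivatives_eq Ψ) μ
  simp only [pdY] at h_coeff
  simp only [pdY, FronsdalField.omega, deg_add_single]
  split_ifs
  all_goals first | exact h_coeff _ | simp only [smul_zero]

theorem finite_omega_ne_zero (ι : Bool → Fin 2) : {μ | Φ.omega bg lam co ι μ ≠ 0}.Finite :=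
  (finite_degree_le N).subset fun _ hμ =>
    le_of_add_le_left ((graded_omega Φ bg co ι).support lam _ hμ).le

theorem sum_act_p_comp_ordApply_omega (o : Bool) {G : Sym} {χ : Bool}
    (hG : ∀ v, MvPolynomial.pderiv (0, v) G = 0) {ι : Fin 2 → Bool → Fin 2}
    (h : ι 0 (!χ) = ι 1 (!χ)) (h₀ : ι 0 χ = 0) (h₁ : ι 1 χ = 1) (C : Gen A) (m : Bool → ℕ) :
    ∑ b, Slot.p.act χ b
        (comp (m + Pi.single χ 1) (ordApply o (starG G) (Φ.omega bg lam co (ι b)) C)) =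
      comp m (ordApply o (starG (G * leg (legOf (!o)) χ 1)) (Φ.omega bg lam co (ι 0)) C) -
        comp m (ordApply o (starG (G * leg (legOf (!o)) χ 0)) (Φ.omega bg lam co (ι 1)) C) := by
  simp only [act_p_comp]
  change ∑ b, compₗ m _ = compₗ m _ - compₗ m _
  rw [← map_sum, ← map_sub, sum_act_p_ordApply o hG (fun b => finite_omega_ne_zero Φ bg co lam _)
    (pdY_omega Φ bg co lam h h₀ h₁)]

end Omega

theorem comp_ordApply_mem_powersIn {o : Bool} {G : Sym} {s : Bool → ℕ}
    (hG : G ∈ degMap (· = 0) (StarRel s (legOf o) (legOf (!o)))) {N N' : ℕ} {f g : ℂ → Gen A}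
    (hf : Graded f gaugeOrder (GaugeDeg N)) (hg : Graded g (weylOrder N') (WeylDeg N'))
    (m : Bool → ℕ) {T : Set ℕ}
    (hT : ∀ a b, StarRel s 1 2 ![m, a, b] → GaugeDeg N a → WeylDeg N' b →
      gaugeOrder a + weylOrder N' b ∈ T) :
    (fun lam => comp m (ordApply o (starG G) (f lam) (g lam))) ∈ powersIn T := by
  have degree_le (a b : Bool → ℕ) (hR : StarRel s 1 2 ![m, a, b]) (ha : GaugeDeg N a) :
      a true + a false ≤ m true + m false + N + s true + s false ∧
        b true + b false ≤ m true + m false + N + s true + s false := by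
    have h_true := hR true
    have h_false := hR false
    simp only [GaugeDeg, Matrix.cons_val] at ha h_true h_false
    omega
  have support (μ ν ρ : Expo) (h : starG G μ ν ρ ≠ 0) :=
    expKernel_support hG (starExponent_mem_degMap s (legs_legOf o)) h
  cases o
  · exact comp_apply_mem_powersIn hg hf m support (fun b a hR _ ha => (degree_le a b hR ha).symm)
      fun b a hR hb ha => add_comm (gaugeOrder a) _ ▸ hT a b hR ha hb
  · exact comp_apply_mem_powersIn hf hg m support (fun a b hR ha _ => degree_le a b hR ha) hT

/-- The star product, multiplied by `z`, of a one-form and a zero-form in the order given by `o`. -/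
def starForm (o : Bool) (z : ℂ) (w : OneForm A) (C : Gen A) : OneForm A :=
  fun ι => ordApply o (starG (MvPolynomial.C z)) (w ι) C

theorem C_mem_degMap_starRel_zero (o : Bool) (z : ℂ) :
    MvPolynomial.C z ∈ degMap (· = 0) (StarRel 0 (legOf o) (legOf (!o))) := by
  rw [← mul_one (MvPolynomial.C z)]
  refine C_mul_mem_degMap z (one_mem_degMap ?_)
  rintro v rfl χ
  simp

theorem C_mul_leg_mem_degMap_starRel (o : Bool) (z : ℂ) (χ : Bool) (b : Fin 2) :
    MvPolynomial.C z * leg (legOf (!o)) χ b ∈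
      degMap (· = 0) (StarRel (pair χ 1 0) (legOf o) (legOf (!o))) := by
  refine C_mul_mem_degMap z (leg_mem_degMap b ?_)
  rintro v rfl c
  cases o <;> cases χ <;> cases c <;> simp [unitDeg, legOf, pair]

theorem C_mul_leg_mul_leg_mem_degMap_starRel (o : Bool) (z : ℂ) (χ : Bool) (b b' : Fin 2) :
    MvPolynomial.C z * leg (legOf (!o)) (!χ) b' * leg (legOf (!o)) χ b ∈
      degMap (· = 0) (StarRel 1 (legOf o) (legOf (!o))) := by
  refine degMap_mul_mem (R := (· = unitDeg (legOf (!o)) (!χ)))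
    (C_mul_mem_degMap z (leg_mem_degMap b' ?_)) (leg_mem_degMap b ?_)
  · rintro v rfl
    exact zero_add _
  · rintro v rfl c
    cases o <;> cases χ <;> cases c <;> simp [unitDeg, legOf]

section StarForm

variable {N N' : ℕ} (Φ : FronsdalField A N) (Φ' : FronsdalField A N') (bg : Background)
  (co : Coefficients) (o : Bool) (z : ℂ) {T : Set ℕ}

theorem starForm_part_at_yy_mem_powersIn (χ : Bool) (m : Bool → ℕ)
    (hT : ∀ a b, StarRel 0 1 2 ![m, a, b] → GaugeDeg N a → WeylDeg N' b →
      gaugeOrder a + weylOrder N' b ∈ T) :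
    (fun lam => ((starForm o z (Φ.omega bg lam co) (Φ'.weyl bg lam co)).part m).at χ .y .y) ∈
      powersIn T :=
  OneForm.part_at_mem_powersIn χ .y .y fun ι => comp_ordApply_mem_powersIn
    (C_mem_degMap_starRel_zero o z) (graded_omega Φ bg co ι) (graded_weyl Φ' bg co) m hT

theorem starForm_part_at_yp_mem_powersIn (χ : Bool) (m : Bool → ℕ)
    (hT : ∀ a b, StarRel (pair χ 0 1) 1 2 ![m, a, b] → GaugeDeg N a → WeylDeg N' b →
      gaugeOrder a + weylOrder N' b ∈ T) :
    (fun lam => ((starForm o z (Φ.omega bg lam co) (Φ'.weyl bg lam co)).part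
      (m + Pi.single (!χ) 1)).at χ .y .p) ∈ powersIn T := by
  have s_eq : (pair χ 0 1 : Bool → ℕ) = pair (!χ) 1 0 := by
    funext c
    cases c <;> cases χ <;> rfl
  have contraction_eq (lam : ℂ) (a : Fin 2) :=
    sum_act_p_comp_ordApply_omega Φ bg co lam o (χ := !χ) (fun _ => MvPolynomial.pderiv_C)
      (ι := fun b => pair χ a b) (by simp [pair]) (by simp [pair]) (by simp [pair])
      (Φ'.weyl bg lam co) m (G := MvPolynomial.C z)
  have factor_mem (b : Fin 2) (ι : Bool → Fin 2) := comp_ordApply_mem_powersIn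
    (C_mul_leg_mem_degMap_starRel o z (!χ) b) (graded_omega Φ bg co ι) (graded_weyl Φ' bg co) m
    (s_eq ▸ hT)
  simp only [OneForm.at, ← Slot.actₗ_apply .y, ← map_sum, OneForm.part, starForm, contraction_eq]
  exact sum_mem_powersIn fun a _ =>
    map_mem_powersIn _ (sub_mem (factor_mem 1 (pair χ a 0)) (factor_mem 0 (pair χ a 1)))

theorem starForm_part_at_pp_mem_powersIn (χ : Bool) (m : Bool → ℕ)
    (hT : ∀ a b, StarRel 1 1 2 ![m, a, b] → GaugeDeg N a → WeylDeg N' b →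
      gaugeOrder a + weylOrder N' b ∈ T) :
    (fun lam => ((starForm o z (Φ.omega bg lam co) (Φ'.weyl bg lam co)).part
      (m + Pi.single χ 1 + Pi.single (!χ) 1)).at χ .p .p) ∈ powersIn T := by
  have contraction_eq (lam : ℂ) (a : Fin 2) :=
    sum_act_p_comp_ordApply_omega Φ bg co lam o (χ := !χ) (fun _ => MvPolynomial.pderiv_C)
      (ι := fun b => pair χ a b) (by simp [pair]) (by simp [pair]) (by simp [pair])
      (Φ'.weyl bg lam co) (m + Pi.single χ 1) (G := MvPolynomial.C z)
  have pderiv_eq_zero (b' : Fin 2) (v : Var) : MvPolynomial.pderiv (0, v)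
      (MvPolynomial.C z * leg (legOf (!o)) (!χ) b') = 0 := by
    rw [MvPolynomial.pderiv_C_mul, pderiv_leg (legOf_ne_zero _), mul_zero]
  have contraction_eq' (lam : ℂ) (b b' : Fin 2) :=
    sum_act_p_comp_ordApply_omega Φ bg co lam o (χ := χ) (pderiv_eq_zero b')
      (ι := fun a => pair χ a b) (by simp [pair]) (by simp [pair]) (by simp [pair])
      (Φ'.weyl bg lam co) m
  have factor_mem (b b' : Fin 2) (ι : Bool → Fin 2) := comp_ordApply_mem_powersIn
    (C_mul_leg_mul_leg_mem_degMap_starRel o z χ b b') (graded_omega Φ bg co ι)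
    (graded_weyl Φ' bg co) m hT
  have act_sub (a : Fin 2) (f g : Gen A) :
      Slot.p.act χ a (f - g) = Slot.p.act χ a f - Slot.p.act χ a g := by
    simp only [← Slot.actₗ_apply, map_sub]
  have sum_act (a : Fin 2) (f : Fin 2 → Gen A) :
      ∑ b, Slot.p.act χ a (f b) = Slot.p.act χ a (∑ b, f b) := by
    simp only [← Slot.actₗ_apply, map_sum]
  simp only [OneForm.at, sum_act, OneForm.part, starForm, contraction_eq, act_sub,
    Finset.sum_sub_distrib, contraction_eq']
  exact sub_mem (sub_mem (factor_mem _ _ _) (factor_mem _ _ _))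
    (sub_mem (factor_mem _ _ _) (factor_mem _ _ _))

end StarForm

/-! ### Derivatives in the star product -/

section Counting

variable {N N' : ℕ} {a b : Bool → ℕ}

theorem gaugeOrder_eq (a : Bool → ℕ) (χ : Bool) :
    gaugeOrder a = ((a χ - a (!χ)) + (a (!χ) - a χ)) / 2 := by
  cases χ
  · exact congrArg (· / 2) (add_comm _ _)
  · rfl

theorem gaugeOrder_add_weylOrder_mem_table0WC_zero {s : Bool → ℕ} (hs : s = 0 ∨ s = 1)
    (h : StarRel s 1 2 ![0, a, b]) (ha : GaugeDeg N a) (hb : WeylDeg N' b) :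
    gaugeOrder a + weylOrder N' b + (1 - s true) ∈ table0WC 0 N N' N' := by
  have hs' : s false = s true ∧ s true ≤ 1 := by rcases hs with rfl | rfl <;> simp
  have h_true := h true
  have h_false := h false
  simp only [GaugeDeg, WeylDeg, Matrix.cons_val, Pi.zero_apply] at ha hb h_true h_false
  have b_true : b true = a true + s true := by omega
  have b_false : b false = a false + s true := by omega
  rw [mem_table0WC_iff, gaugeOrder, weylOrder]
  clear h_true h_false
  refine .inr ⟨.inl rfl, .inl (by omega), ?_⟩
  omega

theorem gaugeOrder_add_weylOrder_mem_table0WC_one {χ : Bool}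
    (h : StarRel (pair χ 0 1) 1 2 ![0, a, b]) (ha : GaugeDeg N a) (hb : WeylDeg N' b) :
    gaugeOrder a + weylOrder N' b ∈ table0WC 1 N N' N' := by
  have h_self := h χ
  have h_not := h (!χ)
  have a_sum := ha.add_not χ
  have b_cases := hb.cases_not χ
  rw [gaugeOrder_eq a χ, weylOrder_eq N' b χ, mem_table0WC_iff]
  simp only [pair, Matrix.cons_val, Pi.zero_apply, Bool.not_eq_self, if_true, if_false] at *
  have b_self : b χ = a χ := by omega
  have b_not : b (!χ) = a (!χ) + 1 := by omega
  clear h_self h_not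
  obtain b_eq | b_eq := b_cases
  · exact .inr ⟨by simp, by omega, by omega⟩
  · obtain rfl | hN := Nat.eq_zero_or_pos N'
    · exact .inr ⟨by simp, by omega, by omega⟩
    · exact .inl ⟨by simp, by omega, by omega⟩

theorem gaugeOrder_add_weylOrder_mem_table0WC_two {χ : Bool}
    (h : StarRel (pair χ 0 1) 1 2 ![pair χ 0 1, a, b]) (ha : GaugeDeg N a) (hb : WeylDeg N' b) :
    gaugeOrder a + weylOrder N' b ∈ table0WC 2 N N' N' := by
  have h_self := h χ
  have h_not := h (!χ)
  have a_sum := ha.add_not χ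
  have b_cases := hb.cases_not χ
  rw [gaugeOrder_eq a χ, weylOrder_eq N' b χ, mem_table0WC_iff]
  simp only [pair, Matrix.cons_val, Bool.not_eq_self, if_true, if_false] at *
  have b_self : b χ = a χ := by omega
  have b_not : b (!χ) = a (!χ) + 2 ∨ (b (!χ) = a (!χ) ∧ 1 ≤ a (!χ)) := by omega
  clear h_self h_not
  obtain b_not | ⟨b_not, a_pos⟩ := b_not
  · obtain b_eq | b_eq := b_cases
    · exact .inr ⟨by simp, by omega, by omega⟩
    · obtain rfl | hN := Nat.eq_zero_or_pos N'
      · exact .inr ⟨by simp, by omega, by omega⟩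
      · exact .inl ⟨by simp, by omega, by omega⟩
  · have order_eq : (a χ - a (!χ) + (a (!χ) - a χ)) / 2 + (N' / 2 + min (b χ) (b (!χ))) + 2 =
        2 / 2 + N / 2 + N' / 2 := by omega
    refine .inl ⟨by simp, by omega, ?_⟩
    obtain hN | hN := Nat.lt_or_ge N' 2
    · exact .inr ⟨trivial, hN, order_eq⟩
    · exact .inl (by omega)

end Counting

theorem carries_starForm (bg : Background) (η : ℂ) {N₁ N N' : ℕ} (Φ : FronsdalField A N)
    (Φ' : FronsdalField A N') (co : Coefficients) (o : Bool) (z : ℂ) :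
    Carries (fun lam => currentZero bg η lam N₁
      (starForm o z (Φ.omega bg lam co) (Φ'.weyl bg lam co))) (table0WC N₁ N N' N') := by
  have pair_eq (χ : Bool) (n : ℕ) : (pair χ 0 (n + 1) : Bool → ℕ) =
      pair χ 0 n + Pi.single (!χ) 1 := by
    funext c
    cases c <;> cases χ <;> simp [pair]
  have pair_zero (χ : Bool) : (pair χ 0 0 : Bool → ℕ) = 0 := funext fun _ => ite_self _
  have pair_one_one : (pair true 1 1 : Bool → ℕ) = 0 + Pi.single true 1 + Pi.single (!true) 1 := by
    funext c
    cases c <;> rfl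
  refine carries_currentZero bg η N₁ ?_ ?_ ?_
  · rintro rfl
    rw [pair_one_one]
    exact starForm_part_at_pp_mem_powersIn Φ Φ' bg co o z true 0 fun a b hR ha hb =>
      gaugeOrder_add_weylOrder_mem_table0WC_zero (.inr rfl) hR ha hb
  · rintro rfl
    rw [pair_zero]
    exact starForm_part_at_yy_mem_powersIn Φ Φ' bg co o z true 0 fun a b hR ha hb =>
      gaugeOrder_add_weylOrder_mem_table0WC_zero (.inl rfl) hR ha hb
  · rintro χ (rfl | rfl) <;> rw [pair_eq] <;>
      refine starForm_part_at_yp_mem_powersIn Φ Φ' bg co o z χ _ fun a b hR ha hb => ?_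
    · rw [pair_zero] at hR
      exact gaugeOrder_add_weylOrder_mem_table0WC_one hR ha hb
    · exact gaugeOrder_add_weylOrder_mem_table0WC_two hR ha hb

/-! ### Currents from the vertices -/

theorem triangle_of_vertexWW_ne_zero {N₁ N₂ N₃ : ℕ} {w₂ w₃ : OneForm A} (h₂ : w₂.HasSpin N₂)
    (h₃ : w₃.HasSpin N₃) (h : (vertexWW w₂ w₃).spinPart N₁ ≠ 0) :
    Triangle (spin N₁) (spin N₂) (spin N₃) := by
  by_contra hT
  refine h ?_
  funext χ a b μ
  refine (if_ctx_congr Iff.rfl (fun hμ => ?_) fun _ => rfl).trans (ite_self 0)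
  have product_eq_zero (ι ι' : Bool → Fin 2) : starKernel.apply (w₂ ι) (w₃ ι') μ = 0 := by
    refine finsum_eq_zero_of_forall_eq_zero fun p => ?_
    by_contra hp
    obtain ⟨hF, hf, hg⟩ := ne_zero_of_apply_term_ne_zero hp
    have hR := starKernel_support (.inl ⟨rfl, rfl⟩) hF
    have h_true := hR true
    have h_false := hR false
    have deg_left := h₂ ι _ hf
    have deg_right := h₃ ι' _ hg
    simp only [Matrix.cons_val, bideg, Pi.zero_apply, add_zero] at h_true h_false
    exact hT (triangle_iff.2 (by omega))
  simp [vertexWW, wedge, product_eq_zero]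

theorem exists_helicity (a : Bool → ℕ) : ∃ τ, a (!τ) ≤ a τ :=
  (le_total (a false) (a true)).elim (⟨true, ·⟩) (⟨false, ·⟩)

theorem mem_iUnion_of_helicity {T : Bool → Bool → Set ℕ} {a b : Bool → ℕ} {k : ℕ}
    (h : ∀ τ₂ τ₃, a (!τ₂) ≤ a τ₂ → b (!τ₃) ≤ b τ₃ → k ∈ T τ₂ τ₃) :
    k ∈ ⋃ (τ₂ : Bool) (τ₃ : Bool), T τ₂ τ₃ := by
  obtain ⟨τ₂, h₂⟩ := exists_helicity a
  obtain ⟨τ₃, h₃⟩ := exists_helicity b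
  exact Set.mem_iUnion₂.2 ⟨τ₂, τ₃, h τ₂ τ₃ h₂ h₃⟩

section Currents

variable {N₁ N₂ N₃ : ℕ} (bg : Background) (η : ℂ) (co : Coefficients)
  (Φ₂ : FronsdalField A N₂) (Φ₃ : FronsdalField A N₃)

theorem carries_vertexWW_hel (τ₂ τ₃ : Bool) :
    Carries (fun lam => currentOne bg lam N₁
      (vertexWW ((Φ₂.omega bg lam co).hel τ₂) ((Φ₃.omega bg lam co).hel τ₃)))
      (tableWW N₁ N₂ N₃ τ₂ τ₃) :=
  carries_currentOne_of_part bg fun _ hm =>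
    vertexWW_part_mem_powersIn (graded_omega_hel Φ₂ bg co τ₂) (graded_omega_hel Φ₃ bg co τ₃)
      (fun _ => And.left) (fun _ => And.left) fun _ _ hR ha hb =>
        gaugeOrder_add_gaugeOrder_mem_tableWW hm hR ha.1 hb.1 ha.2 hb.2

theorem carries_vertexWC_hel (τ₂ τ₃ : Bool) :
    Carries (fun lam => currentOne bg lam N₁
      (vertexWC η ((Φ₂.omega bg lam co).hel τ₂) (helPart τ₃ (Φ₃.weyl bg lam co))))
      (tableWC N₁ N₂ N₃ τ₂ τ₃) :=
  carries_currentOne_of_part bg fun _ hm =>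
    vertexWC_part_mem_powersIn η (graded_omega_hel Φ₂ bg co τ₂)
      ((graded_weyl Φ₃ bg co).helPart τ₃) (fun _ => And.left) (fun _ => And.left)
      fun _ _ _ hR ha hb => gaugeOrder_add_weylOrder_mem_tableWC hm hR ha.1 hb.1 ha.2 hb.2

theorem carries_vertexCW_hel (τ₂ τ₃ : Bool) :
    Carries (fun lam => currentOne bg lam N₁
      (vertexCW η (helPart τ₂ (Φ₂.weyl bg lam co)) ((Φ₃.omega bg lam co).hel τ₃)))
      (tableWC N₁ N₂ N₃ τ₂ τ₃) := by
  rw [tableWC_symm]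
  exact carries_currentOne_of_part bg fun _ hm =>
    vertexCW_part_mem_powersIn η ((graded_weyl Φ₂ bg co).helPart τ₂)
      (graded_omega_hel Φ₃ bg co τ₃) (fun _ => And.left) (fun _ => And.left)
      fun _ _ _ hR ha hb => gaugeOrder_add_weylOrder_mem_tableWC hm hR ha.1 hb.1 ha.2 hb.2

theorem carries_vertexCC_hel (τ₂ τ₃ : Bool) :
    Carries (fun lam => currentOne bg lam N₁
      (vertexCC η (helPart τ₂ (Φ₂.weyl bg lam co)) (helPart τ₃ (Φ₃.weyl bg lam co))))
      (tableCC N₁ N₂ N₃ τ₂ τ₃) :=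
  carries_vertexCC η bg ((graded_weyl Φ₂ bg co).helPart τ₂) ((graded_weyl Φ₃ bg co).helPart τ₃)
    (fun _ => And.left) (fun _ => And.left) fun _ _ _ _ hm hχ hR ha hb =>
      weylOrder_add_weylOrder_mem_tableCC hm hχ hR ha.1 hb.1 ha.2 hb.2

theorem vertexWW_omega_part_mem_powersIn {m : Bool → ℕ} (hm : CurrentDeg N₁ m) :
    (fun lam => (vertexWW (Φ₂.omega bg lam co) (Φ₃.omega bg lam co)).part m) ∈
      powersIn {k | k + diagOrder m ∈ ⋃ (τ₂ : Bool) (τ₃ : Bool), tableWW N₁ N₂ N₃ τ₂ τ₃} :=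
  vertexWW_part_mem_powersIn (graded_omega Φ₂ bg co) (graded_omega Φ₃ bg co)
    (fun _ => id) (fun _ => id) fun _ _ hR ha hb => mem_iUnion_of_helicity fun _ _ =>
      gaugeOrder_add_gaugeOrder_mem_tableWW hm hR ha hb

theorem vertexWC_add_vertexCW_part_mem_powersIn {m : Bool → ℕ} (hm : CurrentDeg N₁ m) :
    (fun lam => (vertexWC η (Φ₂.omega bg lam co) (Φ₃.weyl bg lam co) +
        vertexCW η (Φ₂.weyl bg lam co) (Φ₃.omega bg lam co)).part m) ∈
      powersIn {k | k + diagOrder m ∈ ⋃ (τ₂ : Bool) (τ₃ : Bool), tableWC N₁ N₂ N₃ τ₂ τ₃} := by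
  simp only [TwoForm.part_add]
  exact add_mem
    (vertexWC_part_mem_powersIn η (graded_omega Φ₂ bg co) (graded_weyl Φ₃ bg co)
      (fun _ => id) (fun _ => id) fun _ _ _ hR ha hb => mem_iUnion_of_helicity fun _ _ =>
        gaugeOrder_add_weylOrder_mem_tableWC hm hR ha hb)
    (vertexCW_part_mem_powersIn η (graded_weyl Φ₂ bg co) (graded_omega Φ₃ bg co)
      (fun _ => id) (fun _ => id) fun _ _ _ hR ha hb => mem_iUnion_of_helicity fun τ₂ τ₃ h₂ h₃ =>
        tableWC_symm N₁ N₂ N₃ τ₂ τ₃ ▸ gaugeOrder_add_weylOrder_mem_tableWC hm hR ha hb h₃ h₂)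

theorem carries_vertexCC_weyl :
    Carries (fun lam => currentOne bg lam N₁
      (vertexCC η (Φ₂.weyl bg lam co) (Φ₃.weyl bg lam co)))
      (⋃ (τ₂ : Bool) (τ₃ : Bool), tableCC N₁ N₂ N₃ τ₂ τ₃) :=
  carries_vertexCC η bg (graded_weyl Φ₂ bg co) (graded_weyl Φ₃ bg co)
    (fun _ => id) (fun _ => id) fun _ _ _ _ hm hχ hR ha hb => mem_iUnion_of_helicity fun _ _ =>
      weylOrder_add_weylOrder_mem_tableCC hm hχ hR ha hb

theorem le_of_mem_tableWW {k : ℕ} {τ₂ τ₃ : Bool} (h : k ∈ tableWW N₁ N₂ N₃ τ₂ τ₃) :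
    (k : ℚ) ≤ sumS N₁ N₂ N₃ - 2 * min (spin N₁) (min (spin N₂) (spin N₃)) := by
  rw [mem_tableWW_iff] at h
  rw [min_spin, min_spin, two_mul_spin, le_sumS_sub_iff]
  split_ifs at h <;> omega

theorem le_of_mem_tableWC {k : ℕ} {τ₂ τ₃ : Bool}
    (hT : Triangle (spin N₁) (spin N₂) (spin N₃)) (h : k ∈ tableWC N₁ N₂ N₃ τ₂ τ₃) :
    (k : ℚ) ≤ sumS N₁ N₂ N₃ - 2 * min (spin N₁) (min (spin N₂) (spin N₃)) := by
  rw [mem_tableWC_iff] at h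
  rw [triangle_iff] at hT
  rw [min_spin, min_spin, two_mul_spin, le_sumS_sub_iff]
  obtain ⟨-, h⟩ | ⟨h, -⟩ | ⟨h, -⟩ | ⟨h, -⟩ | ⟨h, -⟩ := h
  · exact h
  all_goals omega

theorem eq_of_mem_tableCC {k : ℕ} {τ₂ τ₃ : Bool}
    (hT : Triangle (spin N₁) (spin N₂) (spin N₃)) (h : k ∈ tableCC N₁ N₂ N₃ τ₂ τ₃) :
    (k : ℚ) = sumS N₁ N₂ N₃ := by
  rw [mem_tableCC_iff] at h
  rw [triangle_iff] at hT
  rw [eq_sumS_iff]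
  obtain ⟨-, -, h⟩ | ⟨-, h, -⟩ := h
  · exact h
  · omega

theorem carries_vertexWW_add_of_triangle (hT : Triangle (spin N₁) (spin N₂) (spin N₃)) :
    Carries (fun lam => currentOne bg lam N₁
      (vertexWW (Φ₂.omega bg lam co) (Φ₃.omega bg lam co) +
        (vertexWC η (Φ₂.omega bg lam co) (Φ₃.weyl bg lam co) +
          vertexCW η (Φ₂.weyl bg lam co) (Φ₃.omega bg lam co))))
      {k | (k : ℚ) ≤ sumS N₁ N₂ N₃ - 2 * min (spin N₁) (min (spin N₂) (spin N₃))} := by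
  refine carries_currentOne_of_part bg fun m hm => ?_
  simp only [TwoForm.part_add _ (_ + _)]
  refine add_mem
    (powersIn_mono (fun k hk => ?_) (vertexWW_omega_part_mem_powersIn bg co Φ₂ Φ₃ hm))
    (powersIn_mono (fun k hk => ?_) (vertexWC_add_vertexCW_part_mem_powersIn bg η co Φ₂ Φ₃ hm))
  · obtain ⟨τ₂, τ₃, hk⟩ := Set.mem_iUnion₂.1 hk
    exact le_of_mem_tableWW hk
  · obtain ⟨τ₂, τ₃, hk⟩ := Set.mem_iUnion₂.1 hk
    exact le_of_mem_tableWC hT hk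

theorem carries_vertexCC_of_triangle (hT : Triangle (spin N₁) (spin N₂) (spin N₃)) :
    Carries (fun lam => currentOne bg lam N₁
      (vertexCC η (Φ₂.weyl bg lam co) (Φ₃.weyl bg lam co))) {k | (k : ℚ) = sumS N₁ N₂ N₃} := by
  refine carries_iff_mem_powersIn.2 (powersIn_mono (fun k hk => ?_)
    (carries_iff_mem_powersIn.1 (carries_vertexCC_weyl bg η co Φ₂ Φ₃)))
  obtain ⟨τ₂, τ₃, hk⟩ := Set.mem_iUnion₂.1 hk
  exact eq_of_mem_tableCC hT hk

theorem vertex0WC_eq_starForm (w : OneForm A) (C : Gen A) :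
    vertex0WC w C = starForm true (-1) w C := by
  funext ι
  refine (neg_one_smul ℂ (starKernel.apply (w ι) C)).symm.trans ((smul_apply ..).symm.trans ?_)
  rw [starKernel_eq, ← starG, ← starG_C_mul, mul_one]
  rfl

theorem vertex0CW_eq_starForm (w : OneForm A) (C : Gen A) :
    vertex0CW C w = starForm false 1 w C := by
  funext ι
  simp only [starForm, map_one]
  rfl

theorem carries_vertex0WC :
    Carries (fun lam => currentZero bg η lam N₁
      (vertex0WC (Φ₂.omega bg lam co) (Φ₃.weyl bg lam co))) (table0WC N₁ N₂ N₃ N₃) := by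
  simp only [vertex0WC_eq_starForm]
  exact carries_starForm bg η Φ₂ Φ₃ co true (-1)

theorem carries_vertex0CW :
    Carries (fun lam => currentZero bg η lam N₁
      (vertex0CW (Φ₂.weyl bg lam co) (Φ₃.omega bg lam co))) (table0WC N₁ N₂ N₃ N₂) := by
  simp only [vertex0CW_eq_starForm, table0WC_symm N₁ N₂]
  exact carries_starForm bg η Φ₃ Φ₂ co false 1

end Currents

end

end HigherSpin

/-- `s_i = N_i / 2`; the factors of a vertex have spins `s₂`, `s₃` in this order. -/
theorem mainTheorem4 {A : Type*} [NormedRing A] [NormedAlgebra ℂ A] (bg : Background) (η : ℂ)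
    (co : Coefficients) (N₁ N₂ N₃ : ℕ) (Φ₂ : FronsdalField A N₂) (Φ₃ : FronsdalField A N₃) :
    -- `Υ(ω, ω)` is nonzero only if the triangle inequalities hold
    (∀ w₂ w₃ : OneForm A, w₂.HasSpin N₂ → w₃.HasSpin N₃ →
      (vertexWW w₂ w₃).spinPart N₁ ≠ 0 → Triangle (spin N₁) (spin N₂) (spin N₃)) ∧
    -- one-form sector, definite signs of the helicities of the two factors
    (∀ τ₂ τ₃ : Bool,
      Carries (fun lam => currentOne bg lam N₁
        (vertexWW ((Φ₂.omega bg lam co).hel τ₂) ((Φ₃.omega bg lam co).hel τ₃)))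
        (tableWW N₁ N₂ N₃ τ₂ τ₃) ∧
      Carries (fun lam => currentOne bg lam N₁
        (vertexWC η ((Φ₂.omega bg lam co).hel τ₂) (helPart τ₃ (Φ₃.weyl bg lam co))))
        (tableWC N₁ N₂ N₃ τ₂ τ₃) ∧
      Carries (fun lam => currentOne bg lam N₁
        (vertexCW η (helPart τ₂ (Φ₂.weyl bg lam co)) ((Φ₃.omega bg lam co).hel τ₃)))
        (tableWC N₁ N₂ N₃ τ₂ τ₃) ∧
      Carries (fun lam => currentOne bg lam N₁
        (vertexCC η (helPart τ₂ (Φ₂.weyl bg lam co)) (helPart τ₃ (Φ₃.weyl bg lam co))))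
        (tableCC N₁ N₂ N₃ τ₂ τ₃)) ∧
    -- one-form sector, complete currents
    Carries (fun lam => currentOne bg lam N₁
      (vertexWW (Φ₂.omega bg lam co) (Φ₃.omega bg lam co)))
      (⋃ (τ₂ : Bool) (τ₃ : Bool), tableWW N₁ N₂ N₃ τ₂ τ₃) ∧
    Carries (fun lam => currentOne bg lam N₁
      (vertexWC η (Φ₂.omega bg lam co) (Φ₃.weyl bg lam co) +
        vertexCW η (Φ₂.weyl bg lam co) (Φ₃.omega bg lam co)))
      (⋃ (τ₂ : Bool) (τ₃ : Bool), tableWC N₁ N₂ N₃ τ₂ τ₃) ∧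
    Carries (fun lam => currentOne bg lam N₁
      (vertexCC η (Φ₂.weyl bg lam co) (Φ₃.weyl bg lam co)))
      (⋃ (τ₂ : Bool) (τ₃ : Bool), tableCC N₁ N₂ N₃ τ₂ τ₃) ∧
    -- the two currents under the triangle inequalities
    (Triangle (spin N₁) (spin N₂) (spin N₃) →
      Carries (fun lam => currentOne bg lam N₁
        (vertexWW (Φ₂.omega bg lam co) (Φ₃.omega bg lam co) +
          (vertexWC η (Φ₂.omega bg lam co) (Φ₃.weyl bg lam co) +
            vertexCW η (Φ₂.weyl bg lam co) (Φ₃.omega bg lam co))))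
        {k | (k : ℚ) ≤ sumS N₁ N₂ N₃ - 2 * min (spin N₁) (min (spin N₂) (spin N₃))} ∧
      Carries (fun lam => currentOne bg lam N₁
        (vertexCC η (Φ₂.weyl bg lam co) (Φ₃.weyl bg lam co)))
        {k | (k : ℚ) = sumS N₁ N₂ N₃}) ∧
    -- zero-form sector
    Carries (fun lam => currentZero bg η lam N₁
      (vertex0WC (Φ₂.omega bg lam co) (Φ₃.weyl bg lam co)))
      (table0WC N₁ N₂ N₃ N₃) ∧
    Carries (fun lam => currentZero bg η lam N₁
      (vertex0CW (Φ₂.weyl bg lam co) (Φ₃.omega bg lam co)))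
      (table0WC N₁ N₂ N₃ N₂) ∧
    Carries (fun lam => currentZero bg η lam N₁
      (vertex0CC η (Φ₂.weyl bg lam co) (Φ₃.weyl bg lam co)))
      (table0CC N₁ N₂ N₃) :=
  ⟨fun _ _ => triangle_of_vertexWW_ne_zero,
    fun τ₂ τ₃ => ⟨carries_vertexWW_hel bg co Φ₂ Φ₃ τ₂ τ₃, carries_vertexWC_hel bg η co Φ₂ Φ₃ τ₂ τ₃,
      carries_vertexCW_hel bg η co Φ₂ Φ₃ τ₂ τ₃, carries_vertexCC_hel bg η co Φ₂ Φ₃ τ₂ τ₃⟩,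
    carries_currentOne_of_part bg fun _ => vertexWW_omega_part_mem_powersIn bg co Φ₂ Φ₃,
    carries_currentOne_of_part bg fun _ => vertexWC_add_vertexCW_part_mem_powersIn bg η co Φ₂ Φ₃,
    carries_vertexCC_weyl bg η co Φ₂ Φ₃,
    fun hT => ⟨carries_vertexWW_add_of_triangle bg η co Φ₂ Φ₃ hT,
      carries_vertexCC_of_triangle bg η co Φ₂ Φ₃ hT⟩,
    carries_vertex0WC bg η co Φ₂ Φ₃, carries_vertex0CW bg η co Φ₂ Φ₃,
    carries_vertex0CC bg η (graded_weyl Φ₂ bg co) (graded_weyl Φ₃ bg co)⟩
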